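/- Let $\tilde{\mathcal A}$ be the $\mathbb C$-algebra of series $\sum_{\nu\ge 0}P_\nu(a)\,b^\nu$ with $P_\nu\in\mathbb C[z]$, where $ab-ba=b^2$ and multiplication by $a$ is continuous for the $b$-adic topology. It contains $\mathbb C[[b]]$. An $(a,b)$-module is a left $\tilde{\mathcal A}$-module that is free of finite rank over $\mathbb C[[b]]$; it is monogenic if it is isomorphic to $\tilde{\mathcal A}/I$ for some left ideal $I$. Let $E^\sharp\subset E[b^{-1}]$ be the saturation of $E$ by $b^{-1}a$, i.e. the smallest $\mathbb C[[b]]$-submodule of $E[b^{-1}]$ that contains $E$ and is stable under $b^{-1}a$. The $(a,b)$-module $E$ is regular if $E^\sharp$ is of finite type over $\mathbb C[[b]]$; its Bernstein polynomial $B_E$ is then the characteristic polynomial of $-b^{-1}a$ acting on the finite-dimensional space $E^\sharp/bE^\sharp$. An element of $\tilde{\mathcal A}$ is homogeneous of degree $k$ and monic in $a$ if it is of the form $\sum_{j=0}^k\lambda_j a^jb^{k-j}$ with $\lambda_j\in\mathbb C$ and $\lambda_k=1$. A Bernstein element of a monogenic regular $(a,b)$-module $E$ of rank $k$ is an element $P\in\tilde{\mathcal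 A}$, homogeneous of degree $k$ and monic in $a$, such that $E\simeq\tilde{\mathcal A}/\tilde{\mathcal A}\,(P+b^2R)$ for some $R\in\tilde{\mathcal A}$ that is a polynomial in $a$ of degree at most $k-1$ with coefficients in $\mathbb C[[b]]$ and has valuation at least $k-1$ in $(a,b)$. **Proposition.** Let $E$ be a monogenic regular $(a,b)$-module and let $0\to F\to E\to G\to 0$ be an exact sequence of $(a,b)$-modules (with $\tilde{\mathcal A}$-linear maps). Then $F$ and $G$ are monogenic and regular; each of $E,F,G$ has exactly one Bernstein element, denoted $P_E,P_F,P_G$ respectively, and $$P_E=P_F\,P_G\quad\text{in }\tilde{\mathcal A}.$$ Moreover $$B_E(x)=B_F\bigl(x-\operatorname{rk}_{\mathbb C[[b]]}G\bigr)\,B_G(x).$$ -/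

import Mathlib

open Polynomial

/-- The underlying set of the algebra `Ã`: the sequence `f` stands for the series
`∑ b ^ n * f n (a)`, with each `f n` a polynomial.  Since `a * b ^ n = b ^ n * a + n * b ^ (n + 1)`,
these are the same as the series `∑ P n (a) * b ^ n`. -/
@[ext] structure ABAlg : Type where
  /-- The sequence of coefficients. -/
  coeff : ℕ → ℂ[X]

namespace ABAlg

instance : CoeFun ABAlg fun _ => ℕ → ℂ[X] := ⟨coeff⟩

/-- An element of `Ã` is the sequence of its coefficients. -/
def equivFun : ABAlg ≃ (ℕ → ℂ[X]) := ⟨coeff, mk, fun _ => rfl, fun _ => rfl⟩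

noncomputable instance : AddCommGroup ABAlg := equivFun.addCommGroup

noncomputable instance : Module ℂ ABAlg := equivFun.module ℂ

theorem ext' {f g : ABAlg} (h : ∀ n, f n = g n) : f = g := ABAlg.ext (funext h)

@[simp] theorem add_apply (f g : ABAlg) (n : ℕ) : (f + g) n = f n + g n := rfl

@[simp] theorem zero_apply (n : ℕ) : (0 : ABAlg) n = 0 := rfl

@[simp] theorem smul_apply (c : ℂ) (f : ABAlg) (n : ℕ) : (c • f) n = c • f n := rfl

/-- The `n`-th coefficient, as a linear map. -/
noncomputable def coeffL (n : ℕ) : ABAlg →ₗ[ℂ] ℂ[X] where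
  toFun f := f n
  map_add' _ _ := rfl
  map_smul' _ _ := rfl

@[simp] theorem coeffL_apply (n : ℕ) (f : ABAlg) : coeffL n f = f n := rfl

theorem sum_apply {ι : Type*} (s : Finset ι) (f : ι → ABAlg) (n : ℕ) :
    (∑ i ∈ s, f i) n = ∑ i ∈ s, f i n := map_sum (coeffL n) f s

/-- Left multiplication by `a`:
`a * ∑ b ^ n * f n (a) = ∑ b ^ n * (a * f n (a)) + ∑ n * b ^ (n + 1) * f n (a)`. -/
noncomputable def opA : Module.End ℂ ABAlg where
  toFun f := mk fun n => match n with
    | 0 => X * f 0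
    | m + 1 => X * f (m + 1) + (m : ℂ[X]) * f m
  map_add' f g := by
    refine ext' fun n => ?_
    cases n
    · simp [mul_add]
    · simp [mul_add]
      ring
  map_smul' c f := by
    refine ext' fun n => ?_
    cases n <;> simp

@[simp] theorem opA_zero (f : ABAlg) : opA f 0 = X * f 0 := rfl

@[simp] theorem opA_succ (f : ABAlg) (m : ℕ) :
    opA f (m + 1) = X * f (m + 1) + (m : ℂ[X]) * f m := rfl

/-- Left multiplication by `b`: `b * ∑ b ^ n * f n (a) = ∑ b ^ (n + 1) * f n (a)`. -/
noncomputable def opB : Module.End ℂ ABAlg where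
  toFun f := mk fun n => match n with
    | 0 => 0
    | m + 1 => f m
  map_add' f g := by
    refine ext' fun n => ?_
    cases n <;> simp
  map_smul' c f := by
    refine ext' fun n => ?_
    cases n <;> simp

@[simp] theorem opB_zero (f : ABAlg) : opB f 0 = 0 := rfl

@[simp] theorem opB_succ (f : ABAlg) (m : ℕ) : opB f (m + 1) = f m := rfl

theorem opB_pow_apply (i : ℕ) (f : ABAlg) (n : ℕ) :
    (opB ^ i) f n = if i ≤ n then f (n - i) else 0 := by
  induction i generalizing n with
  | zero => simp
  | succ i ih =>
    rw [pow_succ', Module.End.mul_apply]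
    cases n with
    | zero => simp
    | succ m => simp [ih]

/-- Left multiplication by `f = ∑ b ^ i * f i (a)` is the (`b`-adically convergent) sum of the
operators `opB ^ i * f i (opA)`. -/
noncomputable def mulL (f : ABAlg) : Module.End ℂ ABAlg where
  toFun g := mk fun n => ∑ p ∈ Finset.HasAntidiagonal.antidiagonal n, (aeval opA (f p.1) g) p.2
  map_add' g h := by
    refine ext' fun n => ?_
    simp [Finset.sum_add_distrib]
  map_smul' c g := by
    refine ext' fun n => ?_
    simp [Finset.smul_sum]

theorem mulL_apply (f g : ABAlg) (n : ℕ) :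
    mulL f g n = ∑ p ∈ Finset.HasAntidiagonal.antidiagonal n, (aeval opA (f p.1) g) p.2 := rfl

noncomputable instance : Mul ABAlg := ⟨fun f g => mulL f g⟩

theorem mul_def (f g : ABAlg) : f * g = mulL f g := rfl

theorem mul_apply (f g : ABAlg) (n : ℕ) :
    (f * g) n = ∑ p ∈ Finset.HasAntidiagonal.antidiagonal n, (aeval opA (f p.1) g) p.2 := rfl

/-- The polynomial `P (a)`. -/
noncomputable def const (P : ℂ[X]) : ABAlg := mk fun n => match n with
  | 0 => P
  | _ + 1 => 0

@[simp] theorem const_zero (P : ℂ[X]) : const P 0 = P := rfl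

@[simp] theorem const_succ (P : ℂ[X]) (n : ℕ) : const P (n + 1) = 0 := rfl

noncomputable instance : One ABAlg := ⟨const 1⟩

theorem one_def : (1 : ABAlg) = const 1 := rfl

theorem mulL_add (f g : ABAlg) : mulL (f + g) = mulL f + mulL g := by
  refine LinearMap.ext fun h => ?_
  refine ext' fun n => ?_
  simp [mulL_apply, Finset.sum_add_distrib]

theorem mulL_smul (c : ℂ) (f : ABAlg) : mulL (c • f) = c • mulL f := by
  refine LinearMap.ext fun h => ?_
  refine ext' fun n => ?_
  simp [mulL_apply, Finset.smul_sum]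

/-- `mulL` as a linear map. -/
noncomputable def mulLL : ABAlg →ₗ[ℂ] Module.End ℂ ABAlg where
  toFun := mulL
  map_add' := mulL_add
  map_smul' := mulL_smul

theorem mulL_opB (f : ABAlg) : mulL (opB f) = opB * mulL f := by
  refine LinearMap.ext fun h => ?_
  refine ext' fun n => ?_
  cases n with
  | zero => simp [mulL_apply]
  | succ m => simp [mulL_apply, Finset.Nat.sum_antidiagonal_succ]

theorem mulL_opA (f : ABAlg) : mulL (opA f) = opA * mulL f := by
  refine LinearMap.ext fun h => ?_
  refine ext' fun n => ?_
  rw [Module.End.mul_apply]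
  cases n with
  | zero => simp [mulL_apply]
  | succ m =>
    have e1 : mulL (opA f) h (m + 1) =
        ∑ p ∈ Finset.HasAntidiagonal.antidiagonal (m + 1), (opA (aeval opA (f p.1) h)) p.2 +
        ∑ p ∈ Finset.HasAntidiagonal.antidiagonal m, (p.1 : ℂ[X]) * (aeval opA (f p.1) h) p.2 := by
      rw [mulL_apply, Finset.Nat.sum_antidiagonal_succ, Finset.Nat.sum_antidiagonal_succ
        (f := fun p : ℕ × ℕ => (opA (aeval opA (f p.1) h)) p.2), add_assoc,
        ← Finset.sum_add_distrib]
      congr 1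
      · simp
      · refine Finset.sum_congr rfl fun p _ => ?_
        have : ∀ k : ℕ, ∀ g : ABAlg, (k • g : ABAlg) p.2 = (k : ℂ[X]) * g p.2 := fun k g => by
          rw [← nsmul_eq_mul]; exact map_nsmul (coeffL p.2) k g
        simp [this]
    rw [e1, Finset.Nat.sum_antidiagonal_succ', opA_succ, mulL_apply, mulL_apply,
      Finset.Nat.sum_antidiagonal_succ' (f := fun p : ℕ × ℕ => (aeval opA (f p.1) h) p.2)]
    simp only [opA_zero, opA_succ, Finset.sum_add_distrib, mul_add, Finset.mul_sum]
    have e2 : ∑ p ∈ Finset.HasAntidiagonal.antidiagonal m, (m : ℂ[X]) * (aeval opA (f p.1) h) p.2 =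
        ∑ p ∈ Finset.HasAntidiagonal.antidiagonal m, (p.2 : ℂ[X]) * (aeval opA (f p.1) h) p.2 +
        ∑ p ∈ Finset.HasAntidiagonal.antidiagonal m, (p.1 : ℂ[X]) * (aeval opA (f p.1) h) p.2 := by
      rw [← Finset.sum_add_distrib]
      refine Finset.sum_congr rfl fun p hp => ?_
      rw [← Finset.HasAntidiagonal.mem_antidiagonal.1 hp]
      push_cast
      ring
    rw [e2]
    ring

theorem mulL_aeval (P : ℂ[X]) (f : ABAlg) : mulL (aeval opA P f) = aeval opA P * mulL f := by
  induction P using Polynomial.induction_on' generalizing f with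
  | add p q hp hq => simp [mulL_add, hp, hq, add_mul]
  | monomial n c =>
    have h : ∀ f, mulL ((opA ^ n) f) = opA ^ n * mulL f := by
      induction n with
      | zero => simp
      | succ n ih =>
        intro f
        rw [pow_succ', Module.End.mul_apply, mulL_opA, ih, mul_assoc]
    simp only [aeval_monomial, Module.End.mul_apply, Module.algebraMap_end_apply, mulL_smul, h]
    refine LinearMap.ext fun g => ?_
    simp

theorem mulL_opB_pow (i : ℕ) (f : ABAlg) : mulL ((opB ^ i) f) = opB ^ i * mulL f := by
  induction i generalizing f with
  | zero => simp
  | succ n ih => rw [pow_succ', Module.End.mul_apply, mulL_opB, ih, mul_assoc]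

theorem mulL_apply_congr {f f' : ABAlg} {n : ℕ} (h : ∀ i ≤ n, f i = f' i) (g : ABAlg) :
    mulL f g n = mulL f' g n := by
  rw [mulL_apply, mulL_apply]
  refine Finset.sum_congr rfl fun p hp => ?_
  rw [h p.1 ((Finset.HasAntidiagonal.mem_antidiagonal.1 hp).symm ▸ Nat.le_add_right _ _)]

theorem mulL_eq_sum (f g : ABAlg) {n m : ℕ} (h : n ≤ m) :
    mulL f g n = (∑ i ∈ Finset.range (m + 1), (opB ^ i) (aeval opA (f i) g)) n := by
  rw [sum_apply, mulL_apply, Finset.Nat.sum_antidiagonal_eq_sum_range_succ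
    (fun i j => (aeval opA (f i) g) j)]
  rw [← Finset.sum_subset (Finset.range_mono (Nat.succ_le_succ h))]
  · refine Finset.sum_congr rfl fun i hi => ?_
    rw [opB_pow_apply, if_pos (Nat.lt_succ_iff.1 (Finset.mem_range.1 hi))]
  · intro i _ hi
    rw [opB_pow_apply, if_neg]
    simpa using hi

theorem mulL_mul (f g : ABAlg) : mulL (mulL f g) = mulL f * mulL g := by
  refine LinearMap.ext fun h => ?_
  refine ext' fun n => ?_
  rw [mulL_apply_congr (fun i hi => mulL_eq_sum f g hi) h, Module.End.mul_apply,
    mulL_eq_sum f (mulL g h) le_rfl]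
  change (mulLL (∑ i ∈ Finset.range (n + 1), (opB ^ i) (aeval opA (f i) g))) h n = _
  rw [map_sum, LinearMap.sum_apply]
  congr 1
  refine Finset.sum_congr rfl fun i _ => ?_
  change mulL ((opB ^ i) (aeval opA (f i) g)) h = _
  rw [mulL_opB_pow, mulL_aeval]
  rfl

theorem aeval_const (P Q : ℂ[X]) : aeval opA P (const Q) = const (P * Q) := by
  have hA : ∀ Q, opA (const Q) = const (X * Q) := fun Q => by
    refine ext' fun n => ?_
    rcases n with _ | _ | n <;> simp
  have hadd : ∀ P Q, const P + const Q = const (P + Q) := fun P Q => by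
    refine ext' fun n => ?_
    cases n <;> simp
  have hsmul : ∀ (c : ℂ) (P), c • const P = const (c • P) := fun c P => by
    refine ext' fun n => ?_
    cases n <;> simp
  induction P using Polynomial.induction_on' generalizing Q with
  | add p q hp hq => simp [hp, hq, add_mul, hadd]
  | monomial n c =>
    have h : ∀ Q, (opA ^ n) (const Q) = const (X ^ n * Q) := by
      induction n with
      | zero => simp
      | succ n ih =>
        intro Q
        rw [pow_succ', Module.End.mul_apply, ih, hA]
        congr 1
        ring
    simp only [aeval_monomial, Module.End.mul_apply, Module.algebraMap_end_apply, h, hsmul]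
    rw [← smul_mul_assoc, ← Polynomial.C_mul', Polynomial.C_mul_X_pow_eq_monomial]

theorem mulL_one : mulL 1 = 1 := by
  refine LinearMap.ext fun g => ?_
  refine ext' fun n => ?_
  rw [mulL_apply]
  cases n with
  | zero => simp [one_def]
  | succ n => simp [one_def, Finset.Nat.sum_antidiagonal_succ]

theorem mulL_apply_one (f : ABAlg) : mulL f 1 = f := by
  refine ext' fun n => ?_
  rw [mulL_apply]
  cases n with
  | zero => simp [one_def, aeval_const]
  | succ n => simp [one_def, aeval_const, Finset.Nat.sum_antidiagonal_succ']

/-- The algebra `Ã`. -/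
noncomputable instance : Ring ABAlg :=
  { (inferInstance : AddCommGroup ABAlg) with
    mul := (· * ·)
    one := 1
    left_distrib := fun f g h => map_add (mulL f) g h
    right_distrib := fun f g h => by simp [mul_def, mulL_add]
    zero_mul := fun f => by
      change mulLL 0 f = 0
      simp
    mul_zero := fun f => map_zero (mulL f)
    mul_assoc := fun f g h => by
      change mulL (mulL f g) h = mulL f (mulL g h)
      rw [mulL_mul]
      rfl
    one_mul := fun f => by
      change mulL 1 f = f
      rw [mulL_one]
      rfl
    mul_one := mulL_apply_one }

noncomputable instance : Algebra ℂ ABAlg :=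
  Algebra.ofModule (fun c f g => by simp [mul_def, mulL_smul])
    (fun c f g => map_smul (mulL f) c g)

/-- The generator `a`. -/
noncomputable def a : ABAlg := const X

/-- The inclusion of `ℂ⟦b⟧`. -/
noncomputable def ofSeries : PowerSeries ℂ →+* ABAlg where
  toFun S := mk fun n => C (PowerSeries.coeff n S)
  map_one' := by
    refine ext' fun n => ?_
    cases n <;> simp [one_def, PowerSeries.coeff_one]
  map_mul' S T := by
    refine ext' fun n => ?_
    rw [mul_apply]
    dsimp only
    rw [PowerSeries.coeff_mul, map_sum]
    refine Finset.sum_congr rfl fun p _ => ?_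
    simp [Polynomial.smul_eq_C_mul]
  map_zero' := by
    refine ext' fun n => ?_
    simp
  map_add' S T := by
    refine ext' fun n => ?_
    simp

theorem ofSeries_apply (S : PowerSeries ℂ) (n : ℕ) :
    ofSeries S n = C (PowerSeries.coeff n S) := rfl

/-- The generator `b`. -/
noncomputable def b : ABAlg := ofSeries PowerSeries.X

theorem a_mul (f : ABAlg) : a * f = opA f := by
  refine ext' fun n => ?_
  rw [mul_apply]
  cases n with
  | zero => simp [a]
  | succ n => simp [a, Finset.Nat.sum_antidiagonal_succ]

theorem b_mul (f : ABAlg) : b * f = opB f := by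
  refine ext' fun n => ?_
  rw [mul_apply]
  cases n with
  | zero => simp [b, ofSeries_apply]
  | succ n =>
    rw [Finset.Nat.sum_antidiagonal_succ]
    cases n with
    | zero => simp [b, ofSeries_apply, PowerSeries.coeff_X]
    | succ n => simp [b, ofSeries_apply, PowerSeries.coeff_X, Finset.Nat.sum_antidiagonal_succ]

/-- `Ã` as a left module over `ℂ⟦b⟧`. -/
noncomputable instance : Module (PowerSeries ℂ) ABAlg := Module.compHom ABAlg ofSeries

theorem series_smul_def (S : PowerSeries ℂ) (f : ABAlg) : S • f = ofSeries S * f := rfl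

instance : IsScalarTower (PowerSeries ℂ) ABAlg ABAlg :=
  ⟨fun S f g => mul_assoc (ofSeries S) f g⟩

theorem ofSeries_mul_apply (S : PowerSeries ℂ) (f : ABAlg) (n : ℕ) :
    (ofSeries S * f) n =
      ∑ p ∈ Finset.HasAntidiagonal.antidiagonal n, PowerSeries.coeff p.1 S • f p.2 := by
  rw [mul_apply]
  refine Finset.sum_congr rfl fun p _ => ?_
  simp [ofSeries_apply]

/-- The commutation rule `a * S(b) = S(b) * a + b ^ 2 * S'(b)`. -/
theorem a_mul_ofSeries (S : PowerSeries ℂ) :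
    a * ofSeries S = ofSeries S * a +
      ofSeries (PowerSeries.X ^ 2 * PowerSeries.derivative ℂ S) := by
  rw [a_mul]
  refine ext' fun n => ?_
  rw [add_apply, ofSeries_mul_apply]
  simp only [ofSeries_apply, PowerSeries.coeff_X_pow_mul']
  rcases n with _ | _ | n
  · simp [a, ofSeries_apply, Polynomial.smul_eq_C_mul, mul_comm X]
  · simp [a, ofSeries_apply, Finset.Nat.sum_antidiagonal_succ', Polynomial.smul_eq_C_mul,
      mul_comm X]
  · simp [a, ofSeries_apply, Finset.Nat.sum_antidiagonal_succ', Polynomial.smul_eq_C_mul,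
      PowerSeries.coeff_derivative, mul_comm X]
    ring

/-- The defining relation `a * b - b * a = b ^ 2`. -/
theorem a_mul_b : a * b - b * a = b ^ 2 := by
  have h := a_mul_ofSeries PowerSeries.X
  rw [PowerSeries.derivative_X, mul_one, map_pow] at h
  exact sub_eq_of_eq_add' h

/-- `P` is homogeneous of degree `k` in `(a, b)` and monic in `a`. -/
def IsHomogeneousMonic (k : ℕ) (P : ABAlg) : Prop :=
  ∃ c : ℕ → ℂ, c k = 1 ∧ P = ∑ j ∈ Finset.range (k + 1), c j • (a ^ j * b ^ (k - j))

/-- `R` is a polynomial in `a` of degree at most `k - 1`, with coefficients in `ℂ⟦b⟧`, whose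
valuation in `(a, b)` is at least `k - 1` (so `R = 0` if `k = 0`). -/
def IsRemainder (k : ℕ) (R : ABAlg) : Prop :=
  ∃ S : ℕ → PowerSeries ℂ, (∀ j < k, PowerSeries.X ^ (k - 1 - j) ∣ S j) ∧
    R = ∑ j ∈ Finset.range k, S j • a ^ j

end ABAlg

namespace ABModule

theorem module_aux₁ {R M : Type*} [CommRing R] [AddCommGroup M] [Module R M]
    (u s x du ds : R) (e e' : M) :
    (u * s * u) • e' + (u * s * (x ^ 2 * du)) • e - (x ^ 2 * (u * ds + s * du) * u) • e =
      (u ^ 2 * s) • e' - (u ^ 2 * (x ^ 2 * ds)) • e := by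
  module

theorem module_aux₂ {R M : Type*} [CommRing R] [AddCommGroup M] [Module R M]
    (s S x dS ds : R) (e e' : M) :
    (s * S) • e' + (s * (x ^ 2 * dS)) • e - (x ^ 2 * ds * S) • e =
      (S * s) • e' - (S * (x ^ 2 * ds)) • e + (x * s * (x * dS)) • e := by
  module

open ABAlg

/-- The multiplicative set of the powers of `b` in `ℂ⟦b⟧`. -/
noncomputable abbrev bPowers : Submonoid (PowerSeries ℂ) := Submonoid.powers PowerSeries.X

section

variable (E : Type*) [AddCommGroup E] [Module ABAlg E] [Module (PowerSeries ℂ) E]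

/-- A left `Ã`-module is an (a,b)-module if it is free of finite type over `ℂ⟦b⟧`.  (The
`ℂ⟦b⟧`-module structure is the restriction of the `Ã`-module structure; this is expressed by
`[IsScalarTower (PowerSeries ℂ) ABAlg E]`.) -/
def IsABModule : Prop :=
  Module.Free (PowerSeries ℂ) E ∧ Module.Finite (PowerSeries ℂ) E

/-- `E` is monogenic: it is isomorphic to `Ã / I` for a left ideal `I`. -/
def IsMonogenic (E : Type*) [AddCommGroup E] [Module ABAlg E] : Prop :=
  ∃ I : Submodule ABAlg ABAlg, Nonempty (E ≃ₗ[ABAlg] ABAlg ⧸ I)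

/-- `P` is a Bernstein element of `E`: with `k` the rank of `E`, `P` is homogeneous of degree `k`
in `(a, b)`, monic in `a`, and `E` is isomorphic to `Ã / Ã x` for some `x = P + b² R` where `R` is
a polynomial in `a` of degree `≤ k - 1` with coefficients in `ℂ⟦b⟧`, of valuation `≥ k - 1`. -/
def IsBernsteinElement (P : ABAlg) : Prop :=
  IsHomogeneousMonic (Module.finrank (PowerSeries ℂ) E) P ∧
    ∃ R : ABAlg, IsRemainder (Module.finrank (PowerSeries ℂ) E) R ∧
      Nonempty (E ≃ₗ[ABAlg] ABAlg ⧸ Submodule.span ABAlg {P + b ^ 2 * R})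

/-- `E[b⁻¹]`. -/
abbrev InvB : Type _ := LocalizedModule bPowers E

variable {E}

theorem a_smul_series_smul [IsScalarTower (PowerSeries ℂ) ABAlg E] (S : PowerSeries ℂ) (e : E) :
    a • (S • e) = S • (a • e) + (PowerSeries.X ^ 2 * PowerSeries.derivative ℂ S) • e := by
  have h : ∀ (T : PowerSeries ℂ) (x : E), T • x = ofSeries T • x := fun T x => by
    rw [← one_smul ABAlg x, ← smul_assoc, series_smul_def, mul_one, one_smul]
  rw [h, h, h, ← mul_smul, ← mul_smul, ← add_smul, a_mul_ofSeries]

theorem X_mul_sq_mem {s : PowerSeries ℂ} (hs : s ∈ bPowers) :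
    PowerSeries.X * s ^ 2 ∈ bPowers :=
  mul_mem (Submonoid.mem_powers _) (pow_mem hs 2)

/-- The value of `b⁻¹ a` on `s⁻¹ e`, from the rule `a s⁻¹ = s⁻¹ a - b² s' s⁻²`. -/
noncomputable def tFun (p : E × bPowers) : InvB E :=
  LocalizedModule.mk
    ((p.2 : PowerSeries ℂ) • (a • p.1) -
      (PowerSeries.X ^ 2 * PowerSeries.derivative ℂ (p.2 : PowerSeries ℂ)) • p.1)
    ⟨PowerSeries.X * (p.2 : PowerSeries ℂ) ^ 2, X_mul_sq_mem p.2.2⟩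

variable [IsScalarTower (PowerSeries ℂ) ABAlg E]

theorem tFun_cancel (e : E) (s u : bPowers) : tFun (u • e, u * s) = tFun (e, s) := by
  have key : tFun (u • e, u * s) = LocalizedModule.mk
      ((u ^ 2) • ((s : PowerSeries ℂ) • (a • e) -
      (PowerSeries.X ^ 2 * PowerSeries.derivative ℂ (s : PowerSeries ℂ)) • e))
      ((u ^ 2) * ⟨PowerSeries.X * (s : PowerSeries ℂ) ^ 2, X_mul_sq_mem s.2⟩) := by
    unfold tFun
    congr 1
    · simp only [Submonoid.smul_def, Submonoid.coe_mul, SubmonoidClass.coe_pow,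
        a_smul_series_smul, Derivation.leibniz, smul_eq_mul]
      generalize a • e = e'
      simp only [smul_add, smul_sub, ← mul_smul]
      exact module_aux₁ _ _ _ _ _ _ _
    · ext1
      simp only [Submonoid.coe_mul, SubmonoidClass.coe_pow]
      ring
  rw [key, LocalizedModule.mk_cancel_common_left]
  rfl

theorem tFun_wd (p q : E × bPowers) (h : p ≈ q) : tFun p = tFun q := by
  obtain ⟨e, s⟩ := p
  obtain ⟨e', s'⟩ := q
  obtain ⟨u, hu⟩ := h
  have h1 := tFun_cancel e s (u * s')
  have h2 := tFun_cancel e' s' (u * s)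
  rw [← h1, ← h2]
  simp only [mul_smul] at hu ⊢
  rw [hu, mul_right_comm]

/-- The operator `b⁻¹ a` on `E[b⁻¹]`. -/
noncomputable def t : InvB E →+ InvB E where
  toFun x := LocalizedModule.liftOn x tFun tFun_wd
  map_zero' := by
    rw [← LocalizedModule.zero_mk (1 : bPowers), LocalizedModule.liftOn_mk]
    simp [tFun]
  map_add' x y := by
    induction x using LocalizedModule.induction_on with | h e s => ?_
    induction y using LocalizedModule.induction_on with | h e' s' => ?_
    have h1 := tFun_cancel e s s'
    have h2 := tFun_cancel e' s' s
    rw [LocalizedModule.mk_add_mk]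
    simp only [LocalizedModule.liftOn_mk]
    rw [← h1, ← h2, mul_comm s' s]
    unfold tFun
    rw [← LocalizedModule.mk_cancel_common_left (⟨_, X_mul_sq_mem (s * s').2⟩ : bPowers)
      ⟨_, X_mul_sq_mem (s * s').2⟩, LocalizedModule.mk_add_mk, ← smul_add]
    congr 2
    simp only [smul_add]
    abel

theorem t_mk (e : E) (s : bPowers) : t (LocalizedModule.mk e s) = tFun (e, s) := rfl

/-- `b⁻¹ a (b⁻ⁿ e) = b⁻⁽ⁿ⁺¹⁾ (a e - n b e)`. -/
theorem t_mk_pow (e : E) (n : ℕ) :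
    t (LocalizedModule.mk e (⟨PowerSeries.X ^ n, n, rfl⟩ : bPowers)) =
      LocalizedModule.mk (a • e - (n : ℕ) • (PowerSeries.X : PowerSeries ℂ) • e)
        (⟨PowerSeries.X ^ (n + 1), n + 1, rfl⟩ : bPowers) := by
  rw [t_mk, ← LocalizedModule.mk_cancel_common_left (⟨PowerSeries.X ^ n, n, rfl⟩ : bPowers)]
  unfold tFun
  congr 1
  · rw [Submonoid.smul_def, smul_sub]
    congr 1
    rw [← Nat.cast_smul_eq_nsmul (PowerSeries ℂ), ← mul_smul, ← mul_smul]
    congr 1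
    cases n with
    | zero => simp
    | succ n =>
      simp only [Derivation.leibniz_pow, PowerSeries.derivative_X, nsmul_eq_mul, smul_eq_mul,
        Nat.add_sub_cancel]
      ring
  · ext1
    simp only [Submonoid.coe_mul]
    ring

/-- `b⁻¹ a (S x) = S (b⁻¹ a x) + b S' x`. -/
theorem t_smul (S : PowerSeries ℂ) (x : InvB E) :
    t (S • x) = S • t x + (PowerSeries.X * PowerSeries.derivative ℂ S) • x := by
  induction x using LocalizedModule.induction_on with | h e s => ?_
  rw [LocalizedModule.smul'_mk, LocalizedModule.smul'_mk, t_mk, t_mk,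
    ← LocalizedModule.mk_cancel_common_left (⟨PowerSeries.X * (s : PowerSeries ℂ), mul_mem
      (Submonoid.mem_powers _) s.2⟩ : bPowers) s ((PowerSeries.X * PowerSeries.derivative ℂ S) • e)]
  have hden : (⟨PowerSeries.X * (s : PowerSeries ℂ), mul_mem (Submonoid.mem_powers _) s.2⟩ : bPowers)
      * s = ⟨PowerSeries.X * (s : PowerSeries ℂ) ^ 2, X_mul_sq_mem s.2⟩ := by
    ext1
    simp only [Submonoid.coe_mul]
    ring
  unfold tFun
  rw [hden, LocalizedModule.smul'_mk, LocalizedModule.mk_add_mk, ← smul_add,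
    LocalizedModule.mk_cancel_common_left]
  congr 1
  simp only [Submonoid.smul_def, a_smul_series_smul]
  generalize a • e = e'
  simp only [smul_add, smul_sub, ← mul_smul]
  exact module_aux₂ _ _ _ _ _ _ _

variable (E)

/-- The saturation `E♯` of `E` by `b⁻¹ a` in `E[b⁻¹]`: the smallest sub-`ℂ⟦b⟧`-module of `E[b⁻¹]`
that contains `E` and is stable under `b⁻¹ a`. -/
noncomputable def saturation : Submodule (PowerSeries ℂ) (InvB E) :=
  sInf {S | LinearMap.range (LocalizedModule.mkLinearMap bPowers E) ≤ S ∧ ∀ x ∈ S, t x ∈ S}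

/-- `E` is regular: `E♯` is of finite type over `ℂ⟦b⟧`. -/
def IsRegular : Prop := (saturation E).FG

variable {E}

theorem t_mem_saturation {x : InvB E} (hx : x ∈ saturation E) : t x ∈ saturation E := by
  rw [saturation, Submodule.mem_sInf] at *
  exact fun S hS => hS.2 x (hx S hS)

variable (E)

/-- `E♯ / b E♯`. -/
def SatQuot : Type _ :=
  saturation E ⧸
    (Ideal.span {(PowerSeries.X : PowerSeries ℂ)} • (⊤ : Submodule (PowerSeries ℂ) (saturation E)))

noncomputable instance : AddCommGroup (SatQuot E) :=
  inferInstanceAs (AddCommGroup (saturation E ⧸ (Ideal.span {(PowerSeries.X : PowerSeries ℂ)} •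
    (⊤ : Submodule (PowerSeries ℂ) (saturation E)))))

noncomputable instance : Module (PowerSeries ℂ) (SatQuot E) :=
  inferInstanceAs (Module (PowerSeries ℂ) (saturation E ⧸
    (Ideal.span {(PowerSeries.X : PowerSeries ℂ)} •
      (⊤ : Submodule (PowerSeries ℂ) (saturation E)))))

noncomputable instance : Module ℂ (SatQuot E) :=
  Module.compHom (SatQuot E) (PowerSeries.C : ℂ →+* PowerSeries ℂ)

/-- The projection `E♯ → E♯ / b E♯`. -/
noncomputable def satMk : saturation E →ₗ[PowerSeries ℂ] SatQuot E :=
  Submodule.mkQ _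

variable {E}

theorem satMk_surjective : Function.Surjective (satMk E) := Submodule.mkQ_surjective _

theorem X_smul_satQuot (q : SatQuot E) : (PowerSeries.X : PowerSeries ℂ) • q = 0 := by
  obtain ⟨x, rfl⟩ := satMk_surjective q
  rw [← map_smul]
  exact (Submodule.Quotient.mk_eq_zero _).2
    (Submodule.smul_mem_smul (Ideal.mem_span_singleton_self _) trivial)

variable (E)

/-- The map `E♯ → E♯ / b E♯` induced by `b⁻¹ a`. -/
noncomputable def satT : saturation E →ₗ[PowerSeries ℂ] SatQuot E where
  toFun x := satMk E ⟨t x.1, t_mem_saturation x.2⟩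
  map_add' x y := by
    rw [← map_add (satMk E)]
    congr 1
    ext1
    simp
  map_smul' S x := by
    have h : (⟨t (S • x).1, t_mem_saturation (S • x).2⟩ : saturation E) =
        S • ⟨t x.1, t_mem_saturation x.2⟩ +
          (PowerSeries.X : PowerSeries ℂ) • PowerSeries.derivative ℂ S • x := by
      ext1
      simp [t_smul, mul_smul]
    rw [h, map_add, map_smul, map_smul, X_smul_satQuot, add_zero, RingHom.id_apply]

theorem smul_top_le_ker_satT : Ideal.span {(PowerSeries.X : PowerSeries ℂ)} •
    (⊤ : Submodule (PowerSeries ℂ) (saturation E)) ≤ LinearMap.ker (satT E) := by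
  rw [Submodule.smul_le]
  intro r hr x _
  obtain ⟨c, rfl⟩ := Ideal.mem_span_singleton'.1 hr
  rw [LinearMap.mem_ker, map_smul, mul_smul, X_smul_satQuot, smul_zero]

/-- The action of `b⁻¹ a` on `E♯ / b E♯`, over `ℂ⟦b⟧`. -/
noncomputable def residueSeries : SatQuot E →ₗ[PowerSeries ℂ] SatQuot E :=
  Submodule.liftQ _ (satT E) (smul_top_le_ker_satT E)

/-- The action of `b⁻¹ a` on `E♯ / b E♯`, a `ℂ`-linear endomorphism. -/
noncomputable def residue : SatQuot E →ₗ[ℂ] SatQuot E where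
  toFun := residueSeries E
  map_add' := map_add (residueSeries E)
  map_smul' c x := map_smul (residueSeries E) (PowerSeries.C c) x

theorem residue_satMk (x : saturation E) :
    residue E (satMk E x) = satMk E ⟨t x.1, t_mem_saturation x.2⟩ := rfl

variable {E}

theorem IsRegular.finite (h : IsRegular E) : Module.Finite ℂ (SatQuot E) := by
  have h1 : Module.Finite (PowerSeries ℂ) (saturation E) := Module.Finite.iff_fg.2 h
  have h2 : Module.Finite (PowerSeries ℂ) (SatQuot E) :=
    Module.Finite.of_surjective (satMk E) satMk_surjective
  obtain ⟨s, hs⟩ := h2.fg_top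
  refine ⟨s, eq_top_iff.2 fun q _ => ?_⟩
  have hq : q ∈ Submodule.span (PowerSeries ℂ) (s : Set (SatQuot E)) := hs ▸ trivial
  induction hq using Submodule.span_induction with
  | mem x hx => exact Submodule.subset_span hx
  | zero => exact zero_mem _
  | add x y _ _ hx hy => exact add_mem (hx trivial) (hy trivial)
  | smul S x _ hx =>
    obtain ⟨T, hT⟩ : (PowerSeries.X : PowerSeries ℂ) ∣
        S - PowerSeries.C (PowerSeries.constantCoeff S) := by
      rw [PowerSeries.X_dvd_iff]
      simp
    have h3 : S • x = (PowerSeries.constantCoeff S) • x := by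
      have h4 := congrArg (· • x) (sub_eq_iff_eq_add.1 hT)
      simp only [add_smul, mul_smul, X_smul_satQuot, zero_add] at h4
      exact h4
    rw [h3]
    exact Submodule.smul_mem _ _ (hx trivial)

/-- The Bernstein polynomial `B_E` of a regular (a,b)-module: the characteristic polynomial of
`-b⁻¹ a` acting on `E♯ / b E♯`. -/
noncomputable def bernsteinPolynomial (h : IsRegular E) : ℂ[X] :=
  haveI := h.finite
  (-residue E).charpoly

end

end ABModule

/-! Everything is read off from the operator `t = b⁻¹ a` on `E[b⁻¹]`, which satisfies `t bⁿ = bⁿ (t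
+ n)`. The homogeneous elements of degree `k` monic in `a` are exactly the `bᵏ p(t)` with `p` monic
of degree `k` (`isHomogeneousMonic_iff`), and `b^f q(t) · b^g p(t) = b^(f+g) q(t + g) p(t)`
(`homogenize_mul`).

Let `e` generate `E`, of rank `k`. Then `E♯` is the `ℂ⟦b⟧`-span of the `p(t) e`
(`saturation_eq_cyclicSpan`), so the class of `e` is a cyclic vector of `t` on `E♯ / b E♯`, a space
of dimension `k`. If `c_E` is the characteristic polynomial of this action, then `c_E ∣ p` if and
only if `p(t) e ∈ b E♯` (`satCharpoly_dvd_iff`). Writing `c_E(t) e` as an element of `b E♯` and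
multiplying by `bᵏ` gives an element `bᵏ c_E(t) + b² R` that kills `e`; division with remainder in
`Ã` shows that it generates the annihilator. Conversely, any relation of this shape forces its
polynomial to be `c_E`. Hence the Bernstein element exists, is unique and equals `bᵏ c_E(t)`.

Both formulas thus reduce to `c_E(t) = c_F(t + g) c_G(t)`, where `g` is the rank of `G`. Let `x =
b^g c_G(t) + b² R` generate the annihilator of the image of `e` in `G`. Then `F` is generated by `x
e = b^g y`, where `y ∈ c_G(t) e + b E♯`. The relation `c_F(t) x e ∈ b F♯` becomes `b^g c_F(t + g) y
∈ b^(g+1) E♯`, so `c_E` divides `c_F(t + g) c_G(t)` (`satCharpoly_dvd_comp_mul`). Both are monic of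
the same degree, by additivity of the rank. -/

/-! ### Polynomials expanded in monic families. -/

/-- Linear maps that agree on `1, X, …, X ^ k` agree on the polynomials of degree at most `k`. -/
theorem Polynomial.linearMap_apply_eq_of_natDegree_le {K M : Type*} [Field K] [AddCommGroup M]
    [Module K M] {f g : K[X] →ₗ[K] M} {k : ℕ} (h : ∀ j ≤ k, f (X ^ j) = g (X ^ j)) {p : K[X]}
    (hp : p.natDegree ≤ k) : f p = g p := by
  rw [p.as_sum_range' (k + 1) (Nat.lt_succ_of_le hp), map_sum, map_sum]
  refine Finset.sum_congr rfl fun j hj => ?_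
  rw [← mul_one (p.coeff j), ← smul_eq_mul, ← smul_monomial, map_smul, map_smul,
    ← X_pow_eq_monomial, h j (Nat.lt_succ_iff.1 (Finset.mem_range.1 hj))]

/-- A sequence of monic polynomials of degrees `0, 1, …, m` spans the polynomials of degree at
most `m`. -/
theorem Polynomial.exists_eq_sum_of_monic {K : Type*} [Field K] {N : ℕ → K[X]} {m : ℕ}
    (hN : ∀ j ≤ m, (N j).Monic ∧ (N j).natDegree = j) {p : K[X]} (hp : p.natDegree ≤ m) :
    ∃ c : ℕ → K, c m = p.coeff m ∧ p = ∑ j ∈ Finset.range (m + 1), c j • N j := by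
  induction m generalizing p with
  | zero =>
    have h0 : N 0 = 1 := eq_one_of_monic_natDegree_zero (hN 0 le_rfl).1 (hN 0 le_rfl).2
    refine ⟨fun _ => p.coeff 0, rfl, ?_⟩
    rw [Finset.sum_range_one, h0, smul_eq_C_mul, mul_one]
    exact eq_C_of_natDegree_le_zero hp
  | succ m ih =>
    obtain ⟨h1, h2⟩ := hN (m + 1) le_rfl
    have hq : (p - p.coeff (m + 1) • N (m + 1)).natDegree ≤ m := by
      refine natDegree_le_iff_coeff_eq_zero.2 fun n hn => ?_
      rcases (Nat.succ_le_of_lt hn).eq_or_lt with rfl | hn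
      · have : (N (m + 1)).coeff (m + 1) = 1 := by
          rw [← h1.coeff_natDegree, h2]
        simp [this]
      · rw [coeff_sub, coeff_smul, coeff_eq_zero_of_natDegree_lt (hp.trans_lt hn),
          coeff_eq_zero_of_natDegree_lt (h2.trans_lt hn), smul_zero, sub_zero]
    obtain ⟨c, -, hc⟩ := ih (fun j hj => hN j (Nat.le_succ_of_le hj)) hq
    refine ⟨Function.update c (m + 1) (p.coeff (m + 1)), by simp, ?_⟩
    rw [Finset.sum_range_succ, Function.update_self, ← sub_eq_iff_eq_add, hc]
    refine Finset.sum_congr rfl fun j hj => ?_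
    rw [Function.update_of_ne (Finset.mem_range.1 hj).ne]

/-- The strict bound fits remainders of division by a monic polynomial of degree `k`, including `k =
0`. -/
theorem Polynomial.exists_eq_sum_of_degree_lt {K : Type*} [Field K] {N : ℕ → K[X]}
    (hN : ∀ j, (N j).Monic ∧ (N j).natDegree = j) {k : ℕ} {p : K[X]} (hp : p.degree < k) :
    ∃ c : ℕ → K, p = ∑ j ∈ Finset.range k, c j • N j := by
  cases k with
  | zero =>
    refine ⟨0, ?_⟩
    rw [Finset.sum_range_zero]
    by_contra h0
    rw [degree_eq_natDegree h0, Nat.cast_lt] at hp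
    exact absurd hp (Nat.not_lt_zero _)
  | succ m =>
    obtain ⟨c, -, hc⟩ := exists_eq_sum_of_monic (m := m) (fun j _ => hN j)
      (natDegree_le_iff_degree_le.2 (Order.le_of_lt_succ (by exact_mod_cast hp)))
    exact ⟨c, hc⟩

/-- Monic polynomials of degree `j`, shifted, are monic of degree `j`. -/
theorem Polynomial.Monic.comp_X_add_natCast {p : ℂ[X]} (hp : p.Monic) (n : ℕ) :
    (p.comp (X + (n : ℂ[X]))).Monic ∧ (p.comp (X + (n : ℂ[X]))).natDegree = p.natDegree := by
  rw [← map_natCast C n]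
  refine ⟨hp.comp_X_add_C _, ?_⟩
  rw [natDegree_comp, natDegree_X_add_C, mul_one]

/-! ### Homogeneous elements of `Ã` as `bᵏ p(b⁻¹ a)`. -/

namespace ABAlg

theorem ofSeries_X : ofSeries PowerSeries.X = b := rfl

theorem a_mul_b_pow (m : ℕ) : a * b ^ m = b ^ m * a + (m : ℂ) • b ^ (m + 1) := by
  have hab : a * b = b * a + b ^ 2 := by rw [← a_mul_b]; abel
  induction m with
  | zero => simp
  | succ m ih =>
    rw [pow_succ, ← mul_assoc, ih, add_mul, mul_assoc, hab, mul_add, smul_mul_assoc, ← pow_succ,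
      ← pow_add, ← mul_assoc]
    push_cast
    rw [add_smul, one_smul]
    abel

/-- The element `b ^ j * (b⁻¹ * a) ^ j = (a - (j - 1) b) ⋯ (a - b) a`. -/
noncomputable def bPowMulT : ℕ → ABAlg
  | 0 => 1
  | j + 1 => (a - (j : ℂ) • b) * bPowMulT j

/-- The element `b ^ k * p (b⁻¹ * a)`, for `p` of degree at most `k`. -/
noncomputable def homogenize (k : ℕ) : ℂ[X] →ₗ[ℂ] ABAlg :=
  ∑ j ∈ Finset.range (k + 1),
    (LinearMap.toSpanSingleton ℂ ABAlg (b ^ (k - j) * bPowMulT j)) ∘ₗ lcoeff ℂ j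

theorem homogenize_X_pow {k j : ℕ} (h : j ≤ k) :
    homogenize k (X ^ j) = b ^ (k - j) * bPowMulT j := by
  rw [homogenize, LinearMap.sum_apply, Finset.sum_eq_single j]
  · simp
  · intro i _ hi
    simp [coeff_X_pow, hi]
  · intro hj
    exact absurd (Finset.mem_range.2 (Nat.lt_succ_of_le h)) hj

/-- The degree bound is needed: `homogenize k` drops the coefficients of degree above `k`, while
`homogenize (k + 1)` keeps one more. -/
theorem b_mul_homogenize {k : ℕ} {p : ℂ[X]} (hp : p.natDegree ≤ k) :
    b * homogenize k p = homogenize (k + 1) p := by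
  refine linearMap_apply_eq_of_natDegree_le (f := LinearMap.mulLeft ℂ b ∘ₗ homogenize k)
    (fun j hj => ?_) hp
  rw [LinearMap.comp_apply, LinearMap.mulLeft_apply, homogenize_X_pow hj,
    homogenize_X_pow (hj.trans k.le_succ), ← mul_assoc, ← pow_succ', Nat.succ_sub hj]

/-- With `t = b⁻¹ a`, one has `a bᵏ p(t) = b t bᵏ p(t) = bᵏ⁺¹ (t + k) p(t)`. -/
theorem a_mul_homogenize {k : ℕ} {p : ℂ[X]} (hp : p.natDegree ≤ k) :
    a * homogenize k p = homogenize (k + 1) ((X + (k : ℂ[X])) * p) := by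
  refine linearMap_apply_eq_of_natDegree_le (f := LinearMap.mulLeft ℂ a ∘ₗ homogenize k)
    (g := homogenize (k + 1) ∘ₗ LinearMap.mulLeft ℂ (X + (k : ℂ[X]))) (fun j hj => ?_) hp
  have h1 : (X + (k : ℂ[X])) * X ^ j = X ^ (j + 1) + (k : ℂ) • X ^ j := by
    rw [smul_eq_C_mul, map_natCast]; ring
  rw [LinearMap.comp_apply, LinearMap.comp_apply, LinearMap.mulLeft_apply, LinearMap.mulLeft_apply,
    homogenize_X_pow hj, h1, map_add, map_smul, homogenize_X_pow (Nat.succ_le_succ hj),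
    homogenize_X_pow (hj.trans k.le_succ), bPowMulT, ← mul_assoc, a_mul_b_pow, Nat.succ_sub hj,
    Nat.succ_sub_succ, Nat.cast_sub hj]
  simp only [add_mul, mul_assoc, mul_sub, sub_mul, smul_mul_assoc, mul_smul_comm, sub_smul,
    pow_succ]
  abel

theorem homogenize_zero_one : homogenize 0 1 = 1 := by
  rw [← pow_zero X, homogenize_X_pow le_rfl]
  simp [bPowMulT]

theorem b_pow_mul_homogenize (m : ℕ) {k : ℕ} {p : ℂ[X]} (hp : p.natDegree ≤ k) :
    b ^ m * homogenize k p = homogenize (m + k) p := by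
  induction m with
  | zero => simp
  | succ m ih =>
    rw [pow_succ', mul_assoc, ih, b_mul_homogenize (hp.trans (Nat.le_add_left _ _)),
      Nat.succ_add]

/-- Moving `b^g` to the left across `q(t)` replaces `t` by `t + g`. This makes the product of
Bernstein elements computable inside `ℂ[X]`. -/
theorem homogenize_mul {f g : ℕ} {p q : ℂ[X]} (hq : q.natDegree ≤ f) (hp : p.natDegree ≤ g) :
    homogenize f q * homogenize g p = homogenize (f + g) (q.comp (X + (g : ℂ[X])) * p) := by
  have key : ∀ j, bPowMulT j * homogenize g p =
      homogenize (j + g) ((X + (g : ℂ[X])) ^ j * p) := by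
    intro j
    induction j with
    | zero => simp [bPowMulT]
    | succ j ih =>
      have hd : ((X + (g : ℂ[X])) ^ j * p).natDegree ≤ j + g := by
        refine natDegree_mul_le.trans (Nat.add_le_add (natDegree_pow_le.trans ?_) hp)
        rw [← map_natCast C g, natDegree_X_add_C, mul_one]
      have h2 : (X + (g : ℂ[X])) ^ (j + 1) * p = (X + ((j + g : ℕ) : ℂ[X])) *
          ((X + (g : ℂ[X])) ^ j * p) - (j : ℂ) • ((X + (g : ℂ[X])) ^ j * p) := by
        rw [smul_eq_C_mul, map_natCast]
        push_cast
        ring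
      rw [bPowMulT, mul_assoc, ih, sub_mul, smul_mul_assoc, a_mul_homogenize hd,
        b_mul_homogenize hd, h2, map_sub, map_smul, Nat.succ_add]
  refine linearMap_apply_eq_of_natDegree_le
    (f := LinearMap.mulRight ℂ (homogenize g p) ∘ₗ homogenize f)
    (g := homogenize (f + g) ∘ₗ LinearMap.mulRight ℂ p ∘ₗ
      (aeval (X + (g : ℂ[X])) : ℂ[X] →ₐ[ℂ] ℂ[X]).toLinearMap) (fun j hj => ?_) hq
  have hd : ((X + (g : ℂ[X])) ^ j * p).natDegree ≤ j + g := by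
    refine natDegree_mul_le.trans (Nat.add_le_add (natDegree_pow_le.trans ?_) hp)
    rw [← map_natCast C g, natDegree_X_add_C, mul_one]
  simp only [LinearMap.comp_apply, LinearMap.mulRight_apply, AlgHom.toLinearMap_apply, map_pow,
    aeval_X]
  rw [homogenize_X_pow hj, mul_assoc, key, b_pow_mul_homogenize _ hd]
  congr 2
  omega

/-- `a ^ j b ^ m = b ^ (j + m) (t + m) (t + m + 1) ⋯ (t + m + j - 1)`, where `t = b⁻¹ a`. -/
theorem a_pow_mul_b_pow (j m : ℕ) : a ^ j * b ^ m =
    homogenize (j + m) ((ascPochhammer ℂ j).comp (X + (m : ℂ[X]))) := by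
  induction j with
  | zero =>
    simpa [homogenize_zero_one] using b_pow_mul_homogenize m (k := 0) (p := 1) (by simp)
  | succ j ih =>
    have hd := ((monic_ascPochhammer ℂ j).comp_X_add_natCast m).2
    rw [ascPochhammer_natDegree] at hd
    rw [pow_succ', mul_assoc, ih, a_mul_homogenize (by omega), ascPochhammer_succ_right,
      mul_comp, Nat.succ_add]
    congr 1
    rw [mul_comm]
    simp [add_assoc, add_comm, add_left_comm]

/-- The change of basis is triangular: `a ^ j * b ^ (k - j)` corresponds to a shifted rising
factorial, monic of degree `j`, so the coefficient of `a ^ k` is the leading coefficient of `p`. -/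
theorem isHomogeneousMonic_iff {k : ℕ} {P : ABAlg} : IsHomogeneousMonic k P ↔
    ∃ p : ℂ[X], p.Monic ∧ p.natDegree = k ∧ P = homogenize k p := by
  set N : ℕ → ℂ[X] := fun j => (ascPochhammer ℂ j).comp (X + ((k - j : ℕ) : ℂ[X])) with hN_def
  have hN : ∀ j, (N j).Monic ∧ (N j).natDegree = j := fun j => by
    have h := (monic_ascPochhammer ℂ j).comp_X_add_natCast (k - j)
    rwa [ascPochhammer_natDegree] at h
  have hsum : ∀ c : ℕ → ℂ, ∑ j ∈ Finset.range (k + 1), c j • (a ^ j * b ^ (k - j)) =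
      homogenize k (∑ j ∈ Finset.range (k + 1), c j • N j) := fun c => by
    rw [map_sum]
    refine Finset.sum_congr rfl fun j hj => ?_
    rw [a_pow_mul_b_pow, map_smul,
      Nat.add_sub_of_le (Nat.lt_succ_iff.1 (Finset.mem_range.1 hj))]
  constructor
  · rintro ⟨c, hc, rfl⟩
    have hd : (∑ j ∈ Finset.range (k + 1), c j • N j).natDegree ≤ k :=
      natDegree_sum_le_of_forall_le _ _ fun j hj => (natDegree_smul_le _ _).trans
        ((hN j).2.le.trans (Nat.lt_succ_iff.1 (Finset.mem_range.1 hj)))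
    have hcoeff : (∑ j ∈ Finset.range (k + 1), c j • N j).coeff k = 1 := by
      rw [finsetSum_coeff, Finset.sum_range_succ, Finset.sum_eq_zero, zero_add, coeff_smul, hc,
        one_smul]
      · have h1 := (hN k).1.coeff_natDegree
        rwa [(hN k).2] at h1
      · intro j hj
        rw [coeff_smul, coeff_eq_zero_of_natDegree_lt, smul_zero]
        rw [(hN j).2]
        exact Finset.mem_range.1 hj
    exact ⟨_, monic_of_natDegree_le_of_coeff_eq_one k hd hcoeff,
      natDegree_eq_of_le_of_coeff_ne_zero hd (by rw [hcoeff]; exact one_ne_zero), hsum c⟩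
  · rintro ⟨p, hp, hk, rfl⟩
    obtain ⟨c, hc, hpc⟩ := exists_eq_sum_of_monic (fun j (_ : j ≤ k) => hN j) hk.le
    refine ⟨c, ?_, ?_⟩
    · rw [hc, ← hk, hp.coeff_natDegree]
    · rw [hsum, ← hpc]

end ABAlg

/-! ### Operators with the Leibniz rule of `b⁻¹ a`, and their cyclic spans. -/

namespace ABModule

theorem _root_.PowerSeries.eq_C_add_X_mul {K : Type*} [CommRing K] (S : PowerSeries K) :
    ∃ T, S = PowerSeries.C (PowerSeries.constantCoeff S) + PowerSeries.X * T := by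
  obtain ⟨T, hT⟩ : (PowerSeries.X : PowerSeries K) ∣
      S - PowerSeries.C (PowerSeries.constantCoeff S) := by
    rw [PowerSeries.X_dvd_iff]
    simp
  exact ⟨T, sub_eq_iff_eq_add'.1 hT⟩

section Leibniz

variable {V : Type*} [AddCommGroup V] [Module (PowerSeries ℂ) V] [Module ℂ V]

/-- `T` behaves like `b⁻¹ a`: it satisfies `T (S x) = S (T x) + b S' x`. -/
def IsLeibniz (T : Module.End ℂ V) : Prop :=
  ∀ (S : PowerSeries ℂ) (x : V),
    T (S • x) = S • T x + (PowerSeries.X * PowerSeries.derivative ℂ S) • x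

/-- The sub-`ℂ⟦b⟧`-module generated by the `p (T) x`. -/
noncomputable def cyclicSpan (T : Module.End ℂ V) (x : V) : Submodule (PowerSeries ℂ) V :=
  Submodule.span _ (Set.range fun p : ℂ[X] => aeval T p x)

variable {T : Module.End ℂ V} {x : V}

theorem aeval_mem_cyclicSpan (T : Module.End ℂ V) (x : V) (p : ℂ[X]) :
    aeval T p x ∈ cyclicSpan T x := Submodule.subset_span ⟨p, rfl⟩

/-- This is the Leibniz rule for `S = bⁿ`, since `b (bⁿ)' = n bⁿ`. -/
theorem IsLeibniz.X_pow_smul (hT : IsLeibniz T) (n : ℕ) (x : V) :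
    T ((PowerSeries.X : PowerSeries ℂ) ^ n • x) =
      (PowerSeries.X : PowerSeries ℂ) ^ n • (T x + n • x) := by
  rw [hT, smul_add, ← Nat.cast_smul_eq_nsmul (PowerSeries ℂ), ← mul_smul]
  congr 2
  cases n with
  | zero => simp
  | succ n =>
    rw [Derivation.leibniz_pow, PowerSeries.derivative_X]
    simp only [nsmul_eq_mul, smul_eq_mul, Nat.add_sub_cancel]
    ring

theorem IsLeibniz.apply_mem_cyclicSpan (hT : IsLeibniz T) {m : V} (hm : m ∈ cyclicSpan T x) :
    T m ∈ cyclicSpan T x := by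
  induction hm using Submodule.span_induction with
  | mem m hm =>
    obtain ⟨p, rfl⟩ := hm
    have h := aeval_mem_cyclicSpan T x (X * p)
    simpa using h
  | zero => simp
  | add m n _ _ hm hn => rw [map_add]; exact add_mem hm hn
  | smul S m hm' hm =>
    rw [hT]
    exact add_mem (Submodule.smul_mem _ _ hm) (Submodule.smul_mem _ _ hm')

/-- A linear map that commutes with the operators maps cyclic spans to cyclic spans. -/
theorem map_cyclicSpan {V' : Type*} [AddCommGroup V'] [Module (PowerSeries ℂ) V'] [Module ℂ V']
    {T' : Module.End ℂ V'} (f : V →ₗ[PowerSeries ℂ] V')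
    (hf : ∀ (p : ℂ[X]) x, f (aeval T p x) = aeval T' p (f x)) :
    (cyclicSpan T x).map f = cyclicSpan T' (f x) := by
  rw [cyclicSpan, Submodule.map_span, ← Set.range_comp, cyclicSpan]
  congr 2
  funext p
  exact hf p x

variable [IsScalarTower ℂ (PowerSeries ℂ) V]

theorem C_smul_eq (c : ℂ) (x : V) : (PowerSeries.C c : PowerSeries ℂ) • x = c • x := by
  rw [← mul_one (PowerSeries.C c), ← PowerSeries.smul_eq_C_mul, smul_assoc, one_smul]

/-- Iterates `T bⁿ = bⁿ (T + n)`. With `n` the rank of `G`, this is the source of the shift in the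
final formulas. -/
theorem IsLeibniz.aeval_X_pow_smul (hT : IsLeibniz T) (p : ℂ[X]) (n : ℕ) (x : V) :
    aeval T p ((PowerSeries.X : PowerSeries ℂ) ^ n • x) =
      (PowerSeries.X : PowerSeries ℂ) ^ n • aeval T (p.comp (X + (n : ℂ[X]))) x := by
  induction p using Polynomial.induction_on generalizing x with
  | C c =>
    simp only [aeval_C, C_comp, Module.algebraMap_end_apply]
    rw [← C_smul_eq, ← C_smul_eq, smul_comm]
  | add p q hp hq => simp [hp, hq]
  | monomial m c ih =>
    rw [pow_succ, ← mul_assoc, map_mul, aeval_X, Module.End.mul_apply, hT.X_pow_smul, ih]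
    simp

theorem aeval_mem_of_stable {S : Submodule (PowerSeries ℂ) V} (hS : ∀ m ∈ S, T m ∈ S) {m : V}
    (hm : m ∈ S) (p : ℂ[X]) : aeval T p m ∈ S := by
  induction p using Polynomial.induction_on generalizing m with
  | C c =>
    rw [aeval_C, Module.algebraMap_end_apply, ← C_smul_eq]
    exact Submodule.smul_mem _ _ hm
  | add p q hp hq =>
    rw [map_add, LinearMap.add_apply]
    exact add_mem (hp hm) (hq hm)
  | monomial n c ih =>
    rw [pow_succ, ← mul_assoc, map_mul, aeval_X, Module.End.mul_apply]
    exact ih (hS _ hm)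

/-- Modulo `b`, every element of the cyclic span of `x` is of the form `p (T) x`. -/
theorem exists_eq_aeval_add_X_smul {m : V} (hm : m ∈ cyclicSpan T x) :
    ∃ p : ℂ[X], ∃ m' ∈ cyclicSpan T x,
      m = aeval T p x + (PowerSeries.X : PowerSeries ℂ) • m' := by
  induction hm using Submodule.span_induction with
  | mem m hm =>
    obtain ⟨p, rfl⟩ := hm
    exact ⟨p, 0, zero_mem _, by simp⟩
  | zero => exact ⟨0, 0, zero_mem _, by simp⟩
  | add m n _ _ hm hn =>
    obtain ⟨p, m', hm', rfl⟩ := hm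
    obtain ⟨q, n', hn', rfl⟩ := hn
    refine ⟨p + q, m' + n', add_mem hm' hn', ?_⟩
    rw [map_add, LinearMap.add_apply, smul_add]
    abel
  | smul S m hm₀ hm =>
    obtain ⟨p, m', hm', h⟩ := hm
    obtain ⟨U, hU⟩ := PowerSeries.eq_C_add_X_mul S
    set c := PowerSeries.constantCoeff S
    -- With `S = c + b U` and `m = p(T) x + b m'`, one has `S m = c p(T) x + b (c m' + U m)`.
    refine ⟨c • p, c • m' + U • m, add_mem ?_ (Submodule.smul_mem _ _ hm₀), ?_⟩
    · rw [← C_smul_eq]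
      exact Submodule.smul_mem _ _ hm'
    · rw [hU, add_smul, mul_smul, smul_add, ← add_assoc, C_smul_eq]
      congr 1
      rw [h, map_smul, LinearMap.smul_apply, smul_add, ← C_smul_eq c ((PowerSeries.X :
        PowerSeries ℂ) • m'), ← C_smul_eq c m', smul_comm]

/-- Since `p(T) bⁿ = bⁿ p(T + n)`, a factor `bⁿ` of the generator can be pulled out of the whole
span. -/
theorem IsLeibniz.exists_of_mem_cyclicSpan_X_pow_smul (hT : IsLeibniz T) (n : ℕ) {m : V}
    (hm : m ∈ cyclicSpan T ((PowerSeries.X : PowerSeries ℂ) ^ n • x)) :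
    ∃ m' ∈ cyclicSpan T x, m = (PowerSeries.X : PowerSeries ℂ) ^ n • m' := by
  induction hm using Submodule.span_induction with
  | mem m hm =>
    obtain ⟨p, rfl⟩ := hm
    exact ⟨_, aeval_mem_cyclicSpan T x _, hT.aeval_X_pow_smul p n x⟩
  | zero => exact ⟨0, zero_mem _, by simp⟩
  | add m n _ _ hm hn =>
    obtain ⟨m', hm', rfl⟩ := hm
    obtain ⟨n', hn', rfl⟩ := hn
    exact ⟨m' + n', add_mem hm' hn', (smul_add _ _ _).symm⟩
  | smul S m _ hm =>
    obtain ⟨m', hm', rfl⟩ := hm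
    exact ⟨S • m', Submodule.smul_mem _ _ hm', smul_comm _ _ _⟩

end Leibniz

/-! ### Characteristic polynomials and cyclic vectors. -/

/-- A cyclic vector is killed by exactly the multiples of the characteristic polynomial. -/
theorem _root_.LinearMap.charpoly_dvd_iff_aeval_apply_eq_zero {K V : Type*} [Field K]
    [AddCommGroup V] [Module K V] [FiniteDimensional K V] (f : Module.End K V) {v : V}
    (hv : ∀ w, ∃ q : K[X], w = aeval f q v) (p : K[X]) :
    f.charpoly ∣ p ↔ aeval f p v = 0 := by
  have hint : IsIntegral K f := Algebra.IsIntegral.isIntegral f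
  -- Reducing `q` modulo the minimal polynomial shows that `V` is the image of the polynomials of
  -- degree less than that of `minpoly K f`; so the minimal and characteristic polynomials coincide.
  have hle : f.charpoly.natDegree ≤ (minpoly K f).natDegree := by
    rw [LinearMap.charpoly_natDegree]
    let φ : degreeLT K (minpoly K f).natDegree →ₗ[K] V :=
      LinearMap.applyₗ v ∘ₗ (aeval f).toLinearMap ∘ₗ Submodule.subtype _
    have hφ : Function.Surjective φ := fun w => by
      obtain ⟨q, rfl⟩ := hv w
      have hm := minpoly.monic hint
      refine ⟨⟨q %ₘ minpoly K f, mem_degreeLT.2 ?_⟩, ?_⟩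
      · rw [← degree_eq_natDegree hm.ne_zero]
        exact degree_modByMonic_lt _ hm
      · conv_rhs => rw [← modByMonic_add_div q (minpoly K f)]
        simp [φ]
    have hfin := LinearEquiv.finrank_eq (degreeLTEquiv K (minpoly K f).natDegree)
    have := (degreeLTEquiv K (minpoly K f).natDegree).symm.finiteDimensional
    refine (LinearMap.finrank_le_finrank_of_surjective hφ).trans ?_
    rw [hfin, Module.finrank_fin_fun]
  have heq : minpoly K f = f.charpoly :=
    (eq_of_monic_of_dvd_of_natDegree_le (minpoly.monic hint) f.charpoly_monic
      (LinearMap.minpoly_dvd_charpoly f) hle).symm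
  constructor
  · rintro ⟨q, rfl⟩
    simp [LinearMap.aeval_self_charpoly]
  · intro h
    rw [← heq]
    refine minpoly.dvd K f (LinearMap.ext fun w => ?_)
    obtain ⟨q, rfl⟩ := hv w
    rw [← Module.End.mul_apply, ← map_mul, mul_comm, map_mul, Module.End.mul_apply, h, map_zero,
      LinearMap.zero_apply]

end ABModule

/-! ### Scalars and reduction modulo `b` in `Ã`. -/

namespace ABAlg

theorem smul_eq_ofSeries_mul (c : ℂ) (f : ABAlg) : c • f = ofSeries (PowerSeries.C c) * f := by
  refine ext' fun n => ?_
  rw [ofSeries_mul_apply, Finset.sum_eq_single (0, n)]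
  · simp
  · rintro ⟨i, j⟩ h hne
    rcases i with _ | i
    · rw [Finset.HasAntidiagonal.mem_antidiagonal] at h
      exact absurd (by simpa using h) hne
    · simp
  · intro h
    exact absurd (Finset.HasAntidiagonal.mem_antidiagonal.2 (by simp)) h

theorem a_pow_eq_const (n : ℕ) : a ^ n = const (X ^ n) := by
  induction n with
  | zero => simp [one_def]
  | succ n ih =>
    have h := aeval_const X (X ^ n)
    rw [aeval_X] at h
    rw [pow_succ', ih, a_mul, h, pow_succ']

theorem exists_eq_const_add_b_mul (f : ABAlg) : ∃ g, f = const (f 0) + b * g := by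
  refine ⟨mk fun n => f (n + 1), ?_⟩
  refine ext' fun n => ?_
  rw [b_mul]
  cases n <;> simp

theorem const_add (P Q : ℂ[X]) : const (P + Q) = const P + const Q := by
  refine ext' fun n => ?_
  cases n <;> simp

theorem const_C_mul_X_pow (c : ℂ) (n : ℕ) : const (C c * X ^ n) = c • a ^ n := by
  rw [a_pow_eq_const]
  refine ext' fun m => ?_
  cases m <;> simp [smul_eq_C_mul]

end ABAlg

/-! ### The module `E[b⁻¹]`, the saturation and its rank. -/

namespace ABModule

open ABAlg

variable {E : Type*} [AddCommGroup E] [Module (PowerSeries ℂ) E]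

noncomputable instance : Module ℂ (InvB E) :=
  Module.compHom (InvB E) (PowerSeries.C : ℂ →+* PowerSeries ℂ)

instance : IsScalarTower ℂ (PowerSeries ℂ) (InvB E) :=
  ⟨fun c S x => by
    rw [PowerSeries.smul_eq_C_mul, mul_smul]
    rfl⟩

/-- The localization map `E → E[b⁻¹]`. -/
noncomputable abbrev toInvB : E →ₗ[PowerSeries ℂ] InvB E := LocalizedModule.mkLinearMap bPowers E

theorem X_pow_smul_injective (n : ℕ) :
    Function.Injective fun x : InvB E => (PowerSeries.X : PowerSeries ℂ) ^ n • x :=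
  IsLocalizedModule.smul_injective (toInvB (E := E))
    (⟨PowerSeries.X ^ n, n, rfl⟩ : bPowers)

theorem bPowers_le_nonZeroDivisors : bPowers ≤ nonZeroDivisors (PowerSeries ℂ) :=
  powers_le_nonZeroDivisors_of_noZeroDivisors PowerSeries.X_ne_zero

theorem toInvB_injective [Module.Free (PowerSeries ℂ) E] :
    Function.Injective (toInvB (E := E)) := by
  intro x y hxy
  obtain ⟨⟨c, n, rfl⟩, hc⟩ := (IsLocalizedModule.eq_iff_exists bPowers toInvB).1 hxy
  exact smul_right_injective E (pow_ne_zero n PowerSeries.X_ne_zero) hc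

variable [Module ABAlg E] [IsScalarTower (PowerSeries ℂ) ABAlg E]

theorem ofSeries_smul (S : PowerSeries ℂ) (e : E) : ofSeries S • e = S • e := by
  conv_rhs => rw [← one_smul ABAlg e, ← smul_assoc, series_smul_def, mul_one]

theorem b_smul (e : E) : b • e = (PowerSeries.X : PowerSeries ℂ) • e :=
  ofSeries_smul _ _

theorem b_pow_smul (m : ℕ) (x : E) : b ^ m • x = (PowerSeries.X : PowerSeries ℂ) ^ m • x := by
  rw [← ofSeries_smul, map_pow, ofSeries_X]

theorem smul_smul_eq (c : ℂ) (f : ABAlg) (e : E) :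
    (c • f) • e = (PowerSeries.C c : PowerSeries ℂ) • (f • e) := by
  rw [smul_eq_ofSeries_mul, mul_smul, ofSeries_smul]

/-- The operator `b⁻¹ a` on `E[b⁻¹]`, as a `ℂ`-linear map. -/
noncomputable def tLin : Module.End ℂ (InvB E) where
  toFun := t
  map_add' := map_add t
  map_smul' c x := by
    have h := t_smul (PowerSeries.C c) x
    rw [PowerSeries.derivative_C, mul_zero, zero_smul, add_zero] at h
    exact h

theorem tLin_apply (x : InvB E) : tLin x = t x := rfl

theorem isLeibniz_tLin : IsLeibniz (tLin (E := E)) := fun S x => t_smul S x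

theorem toInvB_a_smul (e : E) :
    toInvB (a • e) = (PowerSeries.X : PowerSeries ℂ) • tLin (toInvB e) := by
  have h := t_mk_pow e 0
  have h1 : (⟨PowerSeries.X ^ 0, 0, rfl⟩ : bPowers) = 1 := by ext1; simp
  have h2 : (⟨PowerSeries.X ^ (0 + 1), 0 + 1, rfl⟩ : bPowers) =
      ⟨PowerSeries.X, Submonoid.mem_powers _⟩ := by ext1; simp
  rw [h1, h2, zero_smul, sub_zero] at h
  rw [tLin_apply, LocalizedModule.mkLinearMap_apply, LocalizedModule.mkLinearMap_apply, h,
    LocalizedModule.smul'_mk]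
  exact (LocalizedModule.mk_cancel (⟨PowerSeries.X, Submonoid.mem_powers _⟩ : bPowers)
    (a • e)).symm

/-- Inductively `(a - j b) bʲ tʲ = b (t - j) bʲ tʲ = bʲ⁺¹ tʲ⁺¹`, because `t bʲ = bʲ (t + j)`. -/
theorem toInvB_bPowMulT_smul (j : ℕ) (e : E) : toInvB (bPowMulT j • e) =
    (PowerSeries.X : PowerSeries ℂ) ^ j • (tLin ^ j) (toInvB e) := by
  induction j with
  | zero => simp [bPowMulT]
  | succ j ih =>
    rw [bPowMulT, mul_smul, sub_smul, map_sub, toInvB_a_smul, smul_smul_eq,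
      toInvB.map_smul, b_smul, toInvB.map_smul, ih, isLeibniz_tLin.X_pow_smul, pow_succ' tLin,
      Module.End.mul_apply, map_natCast,
      ← Nat.cast_smul_eq_nsmul (PowerSeries ℂ)]
    simp only [smul_add, ← mul_smul, pow_succ, mul_comm, mul_left_comm,
      add_sub_cancel_right]

/-- Justifies reading `homogenize k p` as `bᵏ p(t)`: `b⁻¹` does not exist in `Ã`, but it acts on
`E[b⁻¹]`. -/
theorem toInvB_homogenize_smul {k : ℕ} {p : ℂ[X]} (hp : p.natDegree ≤ k) (e : E) :
    toInvB (homogenize k p • e) =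
      (PowerSeries.X : PowerSeries ℂ) ^ k • aeval tLin p (toInvB e) := by
  let f : ℂ[X] →ₗ[ℂ] InvB E :=
    { toFun := fun p => toInvB (homogenize k p • e)
      map_add' := fun p q => by rw [map_add, add_smul, map_add]
      map_smul' := fun c p => by
        rw [(homogenize k).map_smul, smul_smul_eq, toInvB.map_smul, C_smul_eq]; rfl }
  let g : ℂ[X] →ₗ[ℂ] InvB E :=
    { toFun := fun p => (PowerSeries.X : PowerSeries ℂ) ^ k • aeval tLin p (toInvB e)
      map_add' := fun p q => by rw [map_add, LinearMap.add_apply, smul_add]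
      map_smul' := fun c p => by
        rw [map_smul, LinearMap.smul_apply, ← C_smul_eq, smul_comm, C_smul_eq]; rfl }
  refine linearMap_apply_eq_of_natDegree_le (f := f) (g := g) (fun j hj => ?_) hp
  change toInvB (homogenize k (X ^ j) • e) =
    (PowerSeries.X : PowerSeries ℂ) ^ k • aeval tLin (X ^ j : ℂ[X]) (toInvB e)
  rw [homogenize_X_pow hj, mul_smul, b_pow_smul, toInvB.map_smul, toInvB_bPowMulT_smul,
    ← mul_smul, ← pow_add, Nat.sub_add_cancel hj, map_pow, aeval_X]

theorem toInvB_a_pow_smul (j : ℕ) (e : E) : toInvB (a ^ j • e) =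
    (PowerSeries.X : PowerSeries ℂ) ^ j • aeval tLin (ascPochhammer ℂ j) (toInvB e) := by
  have hd : (ascPochhammer ℂ j).natDegree ≤ j := by rw [ascPochhammer_natDegree]
  rw [← toInvB_homogenize_smul hd]
  have h := a_pow_mul_b_pow j 0
  simp only [pow_zero, mul_one, add_zero, Nat.cast_zero, comp_X] at h
  rw [h]

/-- The powers of `a` applied to a generator generate over `ℂ⟦b⟧`. -/
theorem span_a_pow_smul_eq_top [Module.Finite (PowerSeries ℂ) E] {e : E}
    (he : ∀ x : E, ∃ f : ABAlg, x = f • e) :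
    Submodule.span (PowerSeries ℂ) (Set.range fun n : ℕ => a ^ n • e) = ⊤ := by
  have hc : ∀ P : ℂ[X], const P • e ∈
      Submodule.span (PowerSeries ℂ) (Set.range fun n : ℕ => a ^ n • e) := fun P => by
    induction P using Polynomial.induction_on' with
    | add p q hp hq => rw [const_add, add_smul]; exact add_mem hp hq
    | monomial n c =>
      rw [← C_mul_X_pow_eq_monomial, const_C_mul_X_pow, smul_smul_eq]
      exact Submodule.smul_mem _ _ (Submodule.subset_span ⟨n, rfl⟩)
  -- Nakayama's lemma for the maximal ideal `(b)`: every `f` is a polynomial in `a` modulo `b Ã`.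
  refine top_le_iff.1 (Submodule.le_of_le_smul_of_le_jacobson_bot
    (I := Ideal.span {PowerSeries.X}) Module.Finite.fg_top ?_ fun x _ => ?_)
  · rw [IsLocalRing.jacobson_eq_maximalIdeal _ bot_ne_top]
    exact (PowerSeries.maximalIdeal_eq_span_X (k := ℂ)).ge
  · obtain ⟨f, rfl⟩ := he x
    obtain ⟨g, hg⟩ := exists_eq_const_add_b_mul f
    rw [hg, add_smul, mul_smul, b_smul]
    exact add_mem (Submodule.mem_sup_left (hc _)) (Submodule.mem_sup_right
      (Submodule.smul_mem_smul (Ideal.mem_span_singleton_self _) trivial))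

/-- The cyclic span is stable under `t` by the Leibniz rule. It contains `E`, since `E` is spanned
by the `aⁿ e = bⁿ t (t + 1) ⋯ (t + n - 1) e`. Conversely, a `t`-stable submodule containing `e`
contains every `p(t) e`. -/
theorem saturation_eq_cyclicSpan [Module.Finite (PowerSeries ℂ) E] {e : E}
    (he : ∀ x : E, ∃ f : ABAlg, x = f • e) : saturation E = cyclicSpan tLin (toInvB e) := by
  apply le_antisymm
  · refine sInf_le ⟨?_, fun x hx => isLeibniz_tLin.apply_mem_cyclicSpan hx⟩
    rw [LinearMap.range_eq_map, ← span_a_pow_smul_eq_top he, Submodule.map_span,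
      Submodule.span_le]
    rintro _ ⟨_, ⟨n, rfl⟩, rfl⟩
    rw [toInvB_a_pow_smul]
    exact Submodule.smul_mem _ _ (aeval_mem_cyclicSpan _ _ _)
  · refine le_sInf fun S hS => Submodule.span_le.2 ?_
    have hC : ∀ (c : ℂ), ∀ x ∈ S, c • x ∈ S := fun c x hx => by
      rw [← C_smul_eq]; exact S.smul_mem _ hx
    have hpow : ∀ n : ℕ, (tLin ^ n) (toInvB e) ∈ S := fun n => by
      induction n with
      | zero => exact hS.1 ⟨e, rfl⟩
      | succ n ih => rw [pow_succ', Module.End.mul_apply]; exact hS.2 _ ih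
    rintro _ ⟨p, rfl⟩
    dsimp only
    rw [aeval_eq_sum_range, LinearMap.sum_apply]
    exact sum_mem fun i _ => hC _ _ (hpow i)

theorem toInvB_mem_saturation (e : E) : toInvB e ∈ saturation E := by
  rw [saturation, Submodule.mem_sInf]
  exact fun S hS => hS.1 ⟨e, rfl⟩

/-- `E♯` lies between `E` and `E[b⁻¹]`, which have the same rank. -/
theorem finrank_saturation (h : IsABModule E) :
    Module.finrank (PowerSeries ℂ) (saturation E) = Module.finrank (PowerSeries ℂ) E := by
  have := h.1
  have h1 : Module.rank (PowerSeries ℂ) (saturation E) ≤ Module.rank (PowerSeries ℂ) E :=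
    (Submodule.rank_le _).trans
      (IsLocalizedModule.rank_eq bPowers bPowers_le_nonZeroDivisors toInvB).le
  have h2 : Module.rank (PowerSeries ℂ) E ≤ Module.rank (PowerSeries ℂ) (saturation E) :=
    LinearMap.rank_le_of_injective (LinearMap.codRestrict (saturation E) toInvB
      toInvB_mem_saturation) fun x y hxy => toInvB_injective (congrArg Subtype.val hxy)
  rw [Module.finrank, h1.antisymm h2, Module.finrank]

theorem satMk_eq_zero_iff (m : saturation E) : satMk E m = 0 ↔
    ∃ m' : saturation E, m = (PowerSeries.X : PowerSeries ℂ) • m' := by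
  refine (Submodule.Quotient.mk_eq_zero _).trans ?_
  rw [Submodule.ideal_span_singleton_smul]
  constructor
  · rintro ⟨m', -, h⟩
    exact ⟨m', h.symm⟩
  · rintro ⟨m', rfl⟩
    exact Submodule.smul_mem_pointwise_smul _ _ _ trivial

theorem satMk_C_smul (c : ℂ) (m : saturation E) :
    satMk E ((PowerSeries.C c : PowerSeries ℂ) • m) = c • satMk E m :=
  (satMk E).map_smul _ _

theorem satMk_smul (S : PowerSeries ℂ) (m : saturation E) :
    satMk E (S • m) = PowerSeries.constantCoeff S • satMk E m := by
  obtain ⟨U, hU⟩ := PowerSeries.eq_C_add_X_mul S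
  conv_lhs => rw [hU, add_smul, map_add, satMk_C_smul, mul_smul, (satMk E).map_smul,
    X_smul_satQuot, add_zero]

/-- `E♯` is finite and torsion-free over the principal ideal domain `ℂ⟦b⟧`, hence free; a basis
reduces modulo `b` to a `ℂ`-basis of the quotient. -/
theorem finrank_satQuot (h : IsABModule E) (hr : IsRegular E) :
    Module.finrank ℂ (SatQuot E) = Module.finrank (PowerSeries ℂ) E := by
  have := h.1
  have : Module.IsTorsionFree (PowerSeries ℂ) (InvB E) := by
    refine ⟨fun r hr x y hxy => sub_eq_zero.1 ?_⟩
    obtain ⟨⟨e, s⟩, he⟩ := IsLocalizedModule.surj bPowers toInvB (x - y)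
    have h0 : r • e = 0 := toInvB_injective (by
      rw [toInvB.map_smul, map_zero, ← he, smul_comm, smul_sub, sub_eq_zero.2 hxy, smul_zero])
    have he0 : e = 0 := (smul_eq_zero.1 h0).resolve_left hr.ne_zero
    refine IsLocalizedModule.smul_injective toInvB s ?_
    dsimp only at he ⊢
    rw [he, he0, map_zero, smul_zero]
  have : Module.Finite (PowerSeries ℂ) (saturation E) := Module.Finite.iff_fg.2 hr
  rw [← finrank_saturation h]
  let B := Module.finBasis (PowerSeries ℂ) (saturation E)
  have hli : LinearIndependent ℂ fun i => satMk E (B i) := by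
    rw [Fintype.linearIndependent_iff]
    intro c hc i
    have h1 : satMk E (∑ i, (PowerSeries.C (c i) : PowerSeries ℂ) • B i) = 0 := by
      rw [map_sum, ← hc]
      exact Finset.sum_congr rfl fun i _ => satMk_C_smul _ _
    obtain ⟨m, hm⟩ := (satMk_eq_zero_iff _).1 h1
    have h2 := congrArg (fun m => PowerSeries.constantCoeff (B.repr m i)) hm
    simpa [Finsupp.single_apply] using h2
  have hsp : ⊤ ≤ Submodule.span ℂ (Set.range fun i => satMk E (B i)) := fun q _ => by
    obtain ⟨m, rfl⟩ := satMk_surjective q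
    rw [← B.sum_repr m, map_sum]
    refine sum_mem fun i _ => ?_
    rw [satMk_smul]
    exact Submodule.smul_mem _ _ (Submodule.subset_span ⟨i, rfl⟩)
  rw [Module.finrank_eq_card_basis (Module.Basis.mk hli hsp), Fintype.card_fin]

end ABModule

/-! ### Division with remainder in `Ã`. -/

namespace ABAlg

theorem aeval_opA_apply_zero (P : ℂ[X]) (g : ABAlg) : (aeval opA P g) 0 = P * g 0 := by
  induction P using Polynomial.induction_on generalizing g with
  | C c => simp [smul_eq_C_mul]
  | add p q hp hq => simp [hp, hq, add_mul]
  | monomial n c ih =>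
    rw [pow_succ, ← mul_assoc, map_mul, aeval_X, Module.End.mul_apply, ih, opA_zero, mul_assoc,
      mul_assoc, mul_assoc]

/-- Reduction modulo `b`. -/
noncomputable def reduction : ABAlg →+* ℂ[X] where
  toFun f := f 0
  map_one' := rfl
  map_zero' := rfl
  map_add' _ _ := rfl
  map_mul' f g := by rw [mul_apply]; simp [aeval_opA_apply_zero]

theorem reduction_apply (f : ABAlg) : reduction f = f 0 := rfl

theorem reduction_a : reduction a = X := rfl

theorem reduction_b : reduction b = 0 := by
  rw [reduction_apply, b, ofSeries_apply, PowerSeries.coeff_zero_X, map_zero]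

theorem IsHomogeneousMonic.reduction_eq {k : ℕ} {P : ABAlg} (h : IsHomogeneousMonic k P) :
    reduction P = X ^ k := by
  obtain ⟨c, hc, rfl⟩ := h
  rw [map_sum, Finset.sum_eq_single_of_mem k (Finset.self_mem_range_succ k)]
  · rw [hc, one_smul, Nat.sub_self, pow_zero, mul_one, map_pow, reduction_a]
  · intro j hj hne
    have : k - j ≠ 0 := by
      have := Finset.mem_range.1 hj
      omega
    rw [smul_eq_ofSeries_mul, map_mul, map_mul, map_pow, map_pow, reduction_b, zero_pow this,
      mul_zero, mul_zero]

theorem IsRemainder.exists_eq_sum {k : ℕ} {R : ABAlg} (hR : IsRemainder k R) :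
    ∃ U : ℕ → PowerSeries ℂ, R = ∑ j ∈ Finset.range k,
      ((PowerSeries.X : PowerSeries ℂ) ^ (k - 1 - j) * U j) • a ^ j := by
  obtain ⟨S, hS, rfl⟩ := hR
  have hS' : ∀ j, ∃ U, j < k → S j = (PowerSeries.X : PowerSeries ℂ) ^ (k - 1 - j) * U :=
    fun j => by
      by_cases hj : j < k
      · obtain ⟨U, hU⟩ := hS j hj
        exact ⟨U, fun _ => hU⟩
      · exact ⟨0, fun h => absurd h hj⟩
  choose U hU using hS'
  exact ⟨U, Finset.sum_congr rfl fun j hj => by rw [hU j (Finset.mem_range.1 hj)]⟩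

/-- The coefficients of the quotient in the division of `f` by `x`. -/
noncomputable def quotCoeff (x f : ABAlg) (n : ℕ) : ℂ[X] :=
  (f n - ∑ i : Fin n, (aeval opA (quotCoeff x f i) x) (n - i)) /ₘ x 0
termination_by n
decreasing_by exact i.2

/-- Division with remainder by an element whose reduction modulo `b` is monic of degree `k`. -/
theorem exists_eq_mul_add {k : ℕ} {x : ABAlg} (hx : (reduction x).Monic)
    (hk : (reduction x).natDegree = k) (f : ABAlg) :
    ∃ (q : ABAlg) (S : ℕ → PowerSeries ℂ), f = q * x + ∑ j ∈ Finset.range k, S j • a ^ j := by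
  let q : ABAlg := mk (quotCoeff x f)
  have hr : ∀ n, ((f - q * x) n).degree < k := fun n => by
    have h1 : (f - q * x) n = f n - (q * x) n := map_sub (coeffL n) f (q * x)
    set g := f n - ∑ i : Fin n, (aeval opA (quotCoeff x f i) x) (n - i) with hg
    have hq : quotCoeff x f n = g /ₘ x 0 := by rw [quotCoeff]
    -- The coefficient of `bⁿ` in `q x` is `qₙ x₀` plus terms in the `qᵢ` with `i < n`, which are
    -- already in `g`. So `qₙ` comes from Euclidean division by the monic `x₀`, one power of `b` at
    -- a time.
    have h2 : (f - q * x) n = g %ₘ x 0 := by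
      rw [h1, mul_apply, Finset.Nat.sum_antidiagonal_eq_sum_range_succ
        (fun i j => (aeval opA (q i) x) j), Finset.sum_range_succ, Nat.sub_self,
        aeval_opA_apply_zero, Finset.sum_range, ← sub_sub, ← hg]
      change g - quotCoeff x f n * x 0 = _
      rw [hq, mul_comm, sub_eq_iff_eq_add]
      exact (modByMonic_add_div g (x 0)).symm
    rw [h2, ← hk, ← degree_eq_natDegree hx.ne_zero]
    exact degree_modByMonic_lt _ hx
  -- The series `S j` collects the coefficients of `a ^ j` in the remainders of all orders in `b`.
  refine ⟨q, fun j => PowerSeries.mk fun n => ((f - q * x) n).coeff j, ?_⟩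
  rw [← sub_eq_iff_eq_add']
  refine ext' fun n => ?_
  rw [sum_apply]
  have h3 : ∀ (j : ℕ) (S : PowerSeries ℂ), (S • a ^ j : ABAlg) n =
      PowerSeries.coeff n S • X ^ j := fun j S => by
    rw [series_smul_def, ofSeries_mul_apply, a_pow_eq_const, Finset.sum_eq_single (n, 0)]
    · rfl
    · rintro ⟨i, m⟩ h hne
      rcases m with _ | m
      · rw [Finset.HasAntidiagonal.mem_antidiagonal] at h
        exact absurd (by simpa using h) hne
      · simp
    · intro h
      exact absurd (Finset.HasAntidiagonal.mem_antidiagonal.2 (by simp)) h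
  simp only [h3, PowerSeries.coeff_mk]
  by_cases h0 : (f - q * x) n = 0
  · simp [h0]
  · have h4 := hr n
    rw [degree_eq_natDegree h0, Nat.cast_lt] at h4
    conv_lhs => rw [(f - q * x).coeff n |>.as_sum_range' k h4]
    refine Finset.sum_congr rfl fun j _ => ?_
    rw [smul_X_eq_monomial]

end ABAlg

/-! ### Annihilators of generators and the Bernstein element. -/

namespace ABModule

open ABAlg

variable {E : Type*} [AddCommGroup E] [Module ABAlg E]

theorem IsMonogenic.exists_generator (h : IsMonogenic E) :
    ∃ e : E, ∀ y : E, ∃ f : ABAlg, y = f • e := by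
  obtain ⟨I, ⟨φ⟩⟩ := h
  refine ⟨φ.symm (Submodule.Quotient.mk 1), fun y => ?_⟩
  obtain ⟨f, hf⟩ := Submodule.Quotient.mk_surjective I (φ y)
  refine ⟨f, ?_⟩
  rw [← map_smul, ← Submodule.Quotient.mk_smul, smul_eq_mul, mul_one, hf, φ.symm_apply_apply]

theorem nonempty_linearEquiv_quotient {e : E} (he : ∀ y : E, ∃ f : ABAlg, y = f • e)
    {I : Submodule ABAlg ABAlg} (hI : ∀ f : ABAlg, f • e = 0 ↔ f ∈ I) :
    Nonempty (E ≃ₗ[ABAlg] ABAlg ⧸ I) := by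
  have hker : I = LinearMap.ker (LinearMap.toSpanSingleton ABAlg E e) := by
    ext f
    rw [← hI]
    rfl
  have hsurj : Function.Surjective (LinearMap.toSpanSingleton ABAlg E e) := fun y => by
    obtain ⟨f, rfl⟩ := he y
    exact ⟨f, rfl⟩
  exact ⟨((Submodule.quotEquivOfEq _ _ hker).trans
    (LinearMap.quotKerEquivOfSurjective _ hsurj)).symm⟩

theorem isMonogenic_of_generator {e : E} (he : ∀ y : E, ∃ f : ABAlg, y = f • e) :
    IsMonogenic E :=
  ⟨_, nonempty_linearEquiv_quotient he
    (I := LinearMap.ker (LinearMap.toSpanSingleton ABAlg E e)) fun _ => Iff.rfl⟩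

variable [Module (PowerSeries ℂ) E] [IsScalarTower (PowerSeries ℂ) ABAlg E]

theorem sum_smul_a_pow_smul (k : ℕ) (S : ℕ → PowerSeries ℂ) (e : E) :
    (∑ j ∈ Finset.range k, S j • a ^ j : ABAlg) • e = ∑ j ∈ Finset.range k, S j • (a ^ j • e) := by
  rw [Finset.sum_smul]
  exact Finset.sum_congr rfl fun j _ => smul_assoc _ _ _

/-- An element of the annihilator of a generator, of the form `a ^ k + ⋯` modulo `b` where `k` is
the rank, generates the annihilator. -/
theorem smul_eq_zero_iff_mem_span (hE : IsABModule E) {e : E}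
    (he : ∀ y : E, ∃ f : ABAlg, y = f • e) {x : ABAlg} (hx : (reduction x).Monic)
    (hk : (reduction x).natDegree = Module.finrank (PowerSeries ℂ) E) (hxe : x • e = 0)
    (f : ABAlg) : f • e = 0 ↔ f ∈ Submodule.span ABAlg {x} := by
  constructor
  · intro hf
    have := hE.2
    have hdiv : ∀ f : ABAlg, ∃ (q : ABAlg) (S : ℕ → PowerSeries ℂ),
        f = q * x + ∑ j ∈ Finset.range (Module.finrank (PowerSeries ℂ) E), S j • a ^ j ∧
        f • e = ∑ j : Fin (Module.finrank (PowerSeries ℂ) E), S j • (a ^ (j : ℕ) • e) := fun f => by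
      obtain ⟨q, S, h⟩ := exists_eq_mul_add hx hk f
      refine ⟨q, S, h, ?_⟩
      conv_lhs => rw [h, add_smul, mul_smul, hxe, smul_zero, zero_add, sum_smul_a_pow_smul,
        Finset.sum_range]
    -- By division the `aʲ e` with `j < k` generate `E`; being as many as the rank, they are
    -- independent. The remainder of an element killing `e` is therefore zero.
    have hli : LinearIndependent (PowerSeries ℂ)
        fun j : Fin (Module.finrank (PowerSeries ℂ) E) => a ^ (j : ℕ) • e := by
      refine linearIndependent_of_top_le_span_of_card_eq_finrank (fun y _ => ?_)
        (Fintype.card_fin _)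
      obtain ⟨f, rfl⟩ := he y
      obtain ⟨q, S, -, h⟩ := hdiv f
      rw [h]
      exact sum_mem fun j _ => Submodule.smul_mem _ _ (Submodule.subset_span ⟨j, rfl⟩)
    obtain ⟨q, S, h1, h2⟩ := hdiv f
    rw [hf] at h2
    have h3 := Fintype.linearIndependent_iff.1 hli (fun j => S j) h2.symm
    rw [h1, Finset.sum_range, Finset.sum_eq_zero, add_zero]
    · exact Submodule.mem_span_singleton.2 ⟨q, rfl⟩
    · intro j _
      rw [h3 j, zero_smul]
  · intro h
    obtain ⟨q, rfl⟩ := Submodule.mem_span_singleton.1 h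
    rw [smul_eq_mul, mul_smul, hxe, smul_zero]

/-- The characteristic polynomial of `b⁻¹ a` acting on `E♯ / b E♯`. -/
noncomputable def satCharpoly (h : IsRegular E) : ℂ[X] :=
  haveI := h.finite
  (residue E).charpoly

theorem satCharpoly_monic (h : IsRegular E) : (satCharpoly h).Monic :=
  haveI := h.finite
  LinearMap.charpoly_monic _

theorem natDegree_satCharpoly (hE : IsABModule E) (h : IsRegular E) :
    (satCharpoly h).natDegree = Module.finrank (PowerSeries ℂ) E := by
  have := h.finite
  rw [satCharpoly, LinearMap.charpoly_natDegree, finrank_satQuot hE h]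

theorem aeval_mem_saturation (p : ℂ[X]) {x : InvB E} (hx : x ∈ saturation E) :
    aeval tLin p x ∈ saturation E :=
  aeval_mem_of_stable (fun _ h => t_mem_saturation h) hx p

theorem aeval_residue_satMk (p : ℂ[X]) (x : saturation E) :
    aeval (residue E) p (satMk E x) =
      satMk E ⟨aeval tLin p x.1, aeval_mem_saturation p x.2⟩ := by
  induction p using Polynomial.induction_on generalizing x with
  | C c =>
    simp only [aeval_C, Module.algebraMap_end_apply]
    rw [← satMk_C_smul]
    rfl
  | add p q hp hq =>
    simp only [map_add, LinearMap.add_apply]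
    rw [hp, hq, ← map_add]
    rfl
  | monomial n c ih =>
    simp only [pow_succ, ← mul_assoc, map_mul _ _ X, aeval_X, Module.End.mul_apply]
    rw [residue_satMk, ih]
    rfl

/-- The class of `e` is a cyclic vector of `E♯ / b E♯`, because `E♯` is the cyclic span of `e`; the
right-hand side says that `p(t)` kills this class. -/
theorem satCharpoly_dvd_iff (hE : IsABModule E) (h : IsRegular E) {e : E}
    (he : ∀ y : E, ∃ f : ABAlg, y = f • e) (p : ℂ[X]) : satCharpoly h ∣ p ↔
      ∃ m ∈ saturation E, aeval tLin p (toInvB e) = (PowerSeries.X : PowerSeries ℂ) • m := by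
  have := h.finite
  have := hE.2
  have hv : ∀ w : SatQuot E, ∃ q : ℂ[X],
      w = aeval (residue E) q (satMk E ⟨toInvB e, toInvB_mem_saturation e⟩) := fun w => by
    obtain ⟨⟨m, hm⟩, rfl⟩ := satMk_surjective w
    have hm' := hm
    rw [saturation_eq_cyclicSpan he] at hm'
    obtain ⟨p, m', hm', h⟩ := exists_eq_aeval_add_X_smul hm'
    rw [← saturation_eq_cyclicSpan he] at hm'
    refine ⟨p, ?_⟩
    rw [aeval_residue_satMk, ← sub_eq_zero, ← map_sub, satMk_eq_zero_iff]
    exact ⟨⟨m', hm'⟩, Subtype.ext (sub_eq_iff_eq_add'.2 h)⟩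
  rw [satCharpoly, LinearMap.charpoly_dvd_iff_aeval_apply_eq_zero _ hv, aeval_residue_satMk,
    satMk_eq_zero_iff]
  exact ⟨fun ⟨m, hm⟩ => ⟨m.1, m.2, congrArg Subtype.val hm⟩,
    fun ⟨m, hm, h⟩ => ⟨⟨m, hm⟩, Subtype.ext h⟩⟩

/-- By Nakayama it suffices to generate modulo `b`, where any `p(t) e` may be replaced by the
remainder of `p` modulo `satCharpoly h`. Rising factorials serve as basis because they correspond to
the powers of `a`. -/
theorem exists_eq_sum_of_mem_saturation (hE : IsABModule E) (h : IsRegular E) {e : E}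
    (he : ∀ y : E, ∃ f : ABAlg, y = f • e) {m : InvB E} (hm : m ∈ saturation E) :
    ∃ W : ℕ → PowerSeries ℂ, m = ∑ j ∈ Finset.range (Module.finrank (PowerSeries ℂ) E),
      W j • aeval tLin (ascPochhammer ℂ j) (toInvB e) := by
  have := hE.2
  set k := Module.finrank (PowerSeries ℂ) E with hk
  suffices hle : saturation E ≤ Submodule.span (PowerSeries ℂ)
      ((fun j => aeval tLin (ascPochhammer ℂ j) (toInvB e)) '' (Finset.range k : Set ℕ)) by
    obtain ⟨W, hW⟩ := (Submodule.mem_span_image_finset_iff_exists_fun' _).1 (hle hm)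
    exact ⟨W, hW.symm⟩
  refine Submodule.le_of_le_smul_of_le_jacobson_bot
    (I := Ideal.span {PowerSeries.X}) h ?_ fun m hm => ?_
  · rw [IsLocalRing.jacobson_eq_maximalIdeal _ bot_ne_top]
    exact (PowerSeries.maximalIdeal_eq_span_X (k := ℂ)).ge
  · rw [saturation_eq_cyclicSpan he] at hm
    obtain ⟨p, m', hm', rfl⟩ := exists_eq_aeval_add_X_smul hm
    rw [← saturation_eq_cyclicSpan he] at hm'
    have hc := satCharpoly_monic h
    obtain ⟨m₁, hm₁, h₁⟩ := (satCharpoly_dvd_iff hE h he _).1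
      (dvd_mul_right (satCharpoly h) (p /ₘ satCharpoly h))
    obtain ⟨c, hcs⟩ := exists_eq_sum_of_degree_lt (k := k) (N := ascPochhammer ℂ)
      (fun j => ⟨monic_ascPochhammer ℂ j, by rw [ascPochhammer_natDegree]⟩)
      (p := p %ₘ satCharpoly h) (by
        rw [hk, ← natDegree_satCharpoly hE h, ← degree_eq_natDegree hc.ne_zero]
        exact degree_modByMonic_lt _ hc)
    rw [← modByMonic_add_div p (satCharpoly h), map_add, LinearMap.add_apply, h₁, add_assoc,
      ← smul_add, hcs, map_sum, LinearMap.sum_apply]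
    refine add_mem (Submodule.mem_sup_left (sum_mem fun j hj => ?_)) (Submodule.mem_sup_right
      (Submodule.smul_mem_smul (Ideal.mem_span_singleton_self _) (add_mem hm₁ hm')))
    rw [map_smul, LinearMap.smul_apply, ← C_smul_eq]
    exact Submodule.smul_mem _ _ (Submodule.subset_span ⟨j, hj, rfl⟩)

/-- The valuation condition on `R` is exactly what lets `bᵏ` be factored out: `b² bᵏ⁻¹⁻ʲ aʲ e = bᵏ ·
b · t (t + 1) ⋯ (t + j - 1) e`. -/
theorem toInvB_homogenize_add_smul {k : ℕ} {p : ℂ[X]} (hp : p.natDegree ≤ k)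
    (U : ℕ → PowerSeries ℂ) (e : E) :
    toInvB ((homogenize k p + b ^ 2 * ∑ j ∈ Finset.range k,
      ((PowerSeries.X : PowerSeries ℂ) ^ (k - 1 - j) * U j) • a ^ j : ABAlg) • e) =
    (PowerSeries.X : PowerSeries ℂ) ^ k • (aeval tLin p (toInvB e) +
      (PowerSeries.X : PowerSeries ℂ) • ∑ j ∈ Finset.range k,
        U j • aeval tLin (ascPochhammer ℂ j) (toInvB e)) := by
  rw [add_smul, mul_smul, map_add, toInvB_homogenize_smul hp, sum_smul_a_pow_smul, b_pow_smul,
    toInvB.map_smul, map_sum, smul_add, Finset.smul_sum, Finset.smul_sum, Finset.smul_sum]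
  congr 1
  refine Finset.sum_congr rfl fun j hj => ?_
  rw [toInvB.map_smul, toInvB_a_pow_smul, ← mul_smul, ← mul_smul, ← mul_smul, ← mul_smul]
  congr 1
  obtain ⟨d, rfl⟩ := Nat.exists_eq_add_of_lt (Finset.mem_range.1 hj)
  have : j + d + 1 - 1 - j = d := by omega
  rw [this]
  ring

/-- The annihilator of a generator is generated by `b ^ k * c (b⁻¹ * a)` plus higher order terms,
where `c` is the characteristic polynomial of `b⁻¹ a` on `E♯ / b E♯`. -/
theorem exists_isRemainder_smul_eq_zero (hE : IsABModule E) (h : IsRegular E) {e : E}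
    (he : ∀ y : E, ∃ f : ABAlg, y = f • e) :
    ∃ R, IsRemainder (Module.finrank (PowerSeries ℂ) E) R ∧
      (homogenize (Module.finrank (PowerSeries ℂ) E) (satCharpoly h) + b ^ 2 * R) • e = 0 := by
  have := hE.1
  obtain ⟨m, hm, h1⟩ := (satCharpoly_dvd_iff hE h he _).1 dvd_rfl
  obtain ⟨W, rfl⟩ := exists_eq_sum_of_mem_saturation hE h he hm
  -- With `c(t) e = b ∑ Wⱼ t (t + 1) ⋯ (t + j - 1) e`, this chooses `R = -∑ bᵏ⁻¹⁻ʲ Wⱼ aʲ`.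
  refine ⟨_, ⟨_, fun j _ => Dvd.intro (-W j) rfl, rfl⟩, toInvB_injective ?_⟩
  rw [toInvB_homogenize_add_smul (natDegree_satCharpoly hE h).le, h1, ← smul_add,
    ← Finset.sum_add_distrib, Finset.sum_eq_zero, smul_zero, smul_zero, map_zero]
  intro j _
  rw [neg_smul, add_neg_cancel]

/-- Cancelling `bᵏ` in the relation leaves `p(t) e ∈ b E♯`, so `satCharpoly h` divides `p`; both are
monic of degree `k`. -/
theorem eq_satCharpoly_of_smul_eq_zero (hE : IsABModule E) (h : IsRegular E) {e : E}
    (he : ∀ y : E, ∃ f : ABAlg, y = f • e) {p : ℂ[X]} (hp : p.Monic)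
    (hk : p.natDegree = Module.finrank (PowerSeries ℂ) E) {R : ABAlg}
    (hR : IsRemainder (Module.finrank (PowerSeries ℂ) E) R)
    (h0 : (homogenize (Module.finrank (PowerSeries ℂ) E) p + b ^ 2 * R) • e = 0) :
    p = satCharpoly h := by
  obtain ⟨U, rfl⟩ := hR.exists_eq_sum
  have h1 := congrArg toInvB h0
  rw [toInvB_homogenize_add_smul hk.le, map_zero] at h1
  have h2 := X_pow_smul_injective _ (h1.trans (smul_zero _).symm)
  refine eq_of_monic_of_dvd_of_natDegree_le (satCharpoly_monic h) hp
    ((satCharpoly_dvd_iff hE h he p).2 ⟨_, ?_, eq_neg_of_add_eq_zero_left h2 |>.trans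
      (smul_neg _ _).symm⟩) (by rw [hk, natDegree_satCharpoly hE h])
  exact neg_mem (sum_mem fun j _ => Submodule.smul_mem _ _
    (aeval_mem_saturation _ (toInvB_mem_saturation e)))

theorem isHomogeneousMonic_homogenize_satCharpoly (hE : IsABModule E) (h : IsRegular E) :
    IsHomogeneousMonic (Module.finrank (PowerSeries ℂ) E)
      (homogenize (Module.finrank (PowerSeries ℂ) E) (satCharpoly h)) :=
  isHomogeneousMonic_iff.2 ⟨_, satCharpoly_monic h, natDegree_satCharpoly hE h, rfl⟩

/-- The annihilator of a generator of a regular monogenic (a,b)-module. -/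
theorem exists_isRemainder_smul_eq_zero_iff (hE : IsABModule E) (h : IsRegular E) {e : E}
    (he : ∀ y : E, ∃ f : ABAlg, y = f • e) :
    ∃ R, IsRemainder (Module.finrank (PowerSeries ℂ) E) R ∧ ∀ f : ABAlg, f • e = 0 ↔
      f ∈ Submodule.span ABAlg
        {homogenize (Module.finrank (PowerSeries ℂ) E) (satCharpoly h) + b ^ 2 * R} := by
  obtain ⟨R, hR, h0⟩ := exists_isRemainder_smul_eq_zero hE h he
  have hred : reduction (homogenize (Module.finrank (PowerSeries ℂ) E) (satCharpoly h) +
      b ^ 2 * R) = X ^ Module.finrank (PowerSeries ℂ) E := by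
    rw [map_add, (isHomogeneousMonic_homogenize_satCharpoly hE h).reduction_eq, map_mul, map_pow,
      reduction_b, zero_pow two_ne_zero, zero_mul, add_zero]
  refine ⟨R, hR, fun f => smul_eq_zero_iff_mem_span hE he ?_ ?_ h0 f⟩
  · rw [hred]
    exact monic_X_pow _
  · rw [hred, natDegree_X_pow]

/-- The only Bernstein element of a regular monogenic (a,b)-module of rank `k` is
`b ^ k * c (b⁻¹ * a)`, where `c` is the characteristic polynomial of `b⁻¹ a` on `E♯ / b E♯`. -/
theorem isBernsteinElement_iff (hE : IsABModule E) (hm : IsMonogenic E) (h : IsRegular E)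
    {P : ABAlg} : IsBernsteinElement E P ↔
      P = homogenize (Module.finrank (PowerSeries ℂ) E) (satCharpoly h) := by
  constructor
  · rintro ⟨hP, R, hR, ⟨φ⟩⟩
    obtain ⟨p, hp, hk, rfl⟩ := isHomogeneousMonic_iff.1 hP
    have hmk : ∀ f : ABAlg, f • φ.symm (Submodule.Quotient.mk 1) =
        φ.symm (Submodule.Quotient.mk f) := fun f => by
      rw [← map_smul, ← Submodule.Quotient.mk_smul, smul_eq_mul, mul_one]
    -- Each presentation singles out its own generator, the preimage of `1`, but `satCharpoly h`
    -- depends on `E` alone; hence uniqueness.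
    rw [eq_satCharpoly_of_smul_eq_zero hE h (e := φ.symm (Submodule.Quotient.mk 1))
      (fun y => ?_) hp hk hR]
    · rw [hmk, (Submodule.Quotient.mk_eq_zero _).2 (Submodule.mem_span_singleton_self _), map_zero]
    · obtain ⟨f, hf⟩ := Submodule.Quotient.mk_surjective _ (φ y)
      exact ⟨f, by rw [hmk, hf, φ.symm_apply_apply]⟩
  · rintro rfl
    obtain ⟨e, he⟩ := hm.exists_generator
    obtain ⟨R, hR, hI⟩ := exists_isRemainder_smul_eq_zero_iff hE h he
    exact ⟨isHomogeneousMonic_homogenize_satCharpoly hE h, R, hR,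
      nonempty_linearEquiv_quotient he hI⟩

/-- The Bernstein polynomial in terms of the characteristic polynomial of `b⁻¹ a`. -/
theorem bernsteinPolynomial_eq (hE : IsABModule E) (h : IsRegular E) :
    bernsteinPolynomial h =
      (-1) ^ Module.finrank (PowerSeries ℂ) E * (satCharpoly h).comp (-X) := by
  have := h.finite
  -- For a matrix `A` of size `k`, `det (x + A) = (-1)ᵏ det (-x - A)`.
  refine Polynomial.funext fun x => ?_
  rw [bernsteinPolynomial, satCharpoly, ← finrank_satQuot hE h, ← LinearMap.charpoly_toMatrix _
    (Module.finBasis ℂ (SatQuot E)), ← LinearMap.charpoly_toMatrix _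
    (Module.finBasis ℂ (SatQuot E)), eval_mul, eval_comp, Matrix.eval_charpoly,
    Matrix.eval_charpoly]
  simp only [eval_neg, eval_X, eval_pow, eval_one]
  rw [map_neg, sub_neg_eq_add, map_neg, ← neg_add', Matrix.det_neg, Fintype.card_fin, ← mul_assoc,
    ← pow_add, ← two_mul, pow_mul, neg_one_sq, one_pow, one_mul]

end ABModule

/-! ### Functoriality and exact sequences. -/

namespace ABModule

open ABAlg

variable {E : Type*} [AddCommGroup E] [Module ABAlg E]
variable {E' : Type*} [AddCommGroup E'] [Module ABAlg E']

theorem exists_generator_of_surjective {p : E →ₗ[ABAlg] E'} (hp : Function.Surjective p) {e : E}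
    (he : ∀ y : E, ∃ f : ABAlg, y = f • e) (z : E') : ∃ f : ABAlg, z = f • p e := by
  obtain ⟨y, rfl⟩ := hp z
  obtain ⟨f, rfl⟩ := he y
  exact ⟨f, map_smul p f e⟩

variable [Module (PowerSeries ℂ) E] [IsScalarTower (PowerSeries ℂ) ABAlg E]
variable [Module (PowerSeries ℂ) E'] [IsScalarTower (PowerSeries ℂ) ABAlg E']

/-- An `Ã`-linear map, as a `ℂ⟦b⟧`-linear map. -/
noncomputable def restrictSeries (φ : E →ₗ[ABAlg] E') : E →ₗ[PowerSeries ℂ] E' where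
  toFun := φ
  map_add' := map_add φ
  map_smul' S x := by rw [← ofSeries_smul, map_smul, ofSeries_smul, RingHom.id_apply]

theorem restrictSeries_apply (φ : E →ₗ[ABAlg] E') (x : E) : restrictSeries φ x = φ x := rfl

/-- The map `E[b⁻¹] → E'[b⁻¹]` induced by an `Ã`-linear map. -/
noncomputable def mapInvB (φ : E →ₗ[ABAlg] E') : InvB E →ₗ[PowerSeries ℂ] InvB E' :=
  (LocalizedModule.map bPowers (restrictSeries φ)).restrictScalars (PowerSeries ℂ)

theorem mapInvB_mk (φ : E →ₗ[ABAlg] E') (x : E) (s : bPowers) :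
    mapInvB φ (LocalizedModule.mk x s) = LocalizedModule.mk (φ x) s :=
  IsLocalizedModule.map_LocalizedModules bPowers (restrictSeries φ) x s

theorem mapInvB_toInvB (φ : E →ₗ[ABAlg] E') (x : E) :
    mapInvB φ (toInvB x) = toInvB (φ x) := mapInvB_mk φ x 1

theorem mapInvB_injective {φ : E →ₗ[ABAlg] E'} (h : Function.Injective φ) :
    Function.Injective (mapInvB φ) :=
  LocalizedModule.map_injective bPowers (restrictSeries φ) h

theorem mapInvB_tLin (φ : E →ₗ[ABAlg] E') (x : InvB E) :
    mapInvB φ (tLin x) = tLin (mapInvB φ x) := by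
  induction x using LocalizedModule.induction_on with | h e s => ?_
  rw [mapInvB_mk, tLin_apply, tLin_apply, t_mk, t_mk, tFun, tFun, mapInvB_mk]
  congr 1
  simp only [map_sub, ← restrictSeries_apply, map_smul]
  simp only [restrictSeries_apply, map_smul]

theorem mapInvB_aeval_tLin (φ : E →ₗ[ABAlg] E') (p : ℂ[X]) (x : InvB E) :
    mapInvB φ (aeval tLin p x) = aeval tLin p (mapInvB φ x) := by
  induction p using Polynomial.induction_on generalizing x with
  | C c =>
    rw [aeval_C, aeval_C, Module.algebraMap_end_apply, Module.algebraMap_end_apply, ← C_smul_eq,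
      ← C_smul_eq, map_smul]
  | add p q hp hq =>
    rw [map_add, map_add, LinearMap.add_apply, LinearMap.add_apply, map_add, hp, hq]
  | monomial n c ih =>
    simp only [pow_succ, ← mul_assoc, map_mul _ _ X, aeval_X, Module.End.mul_apply]
    rw [ih, mapInvB_tLin]

theorem map_mapInvB_cyclicSpan (φ : E →ₗ[ABAlg] E') (e : E) :
    (cyclicSpan tLin (toInvB e)).map (mapInvB φ) = cyclicSpan tLin (toInvB (φ e)) := by
  rw [map_cyclicSpan (mapInvB φ) (mapInvB_aeval_tLin φ), mapInvB_toInvB]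

/-- The saturation of the quotient is the image of `E♯`, since cyclic spans map onto cyclic spans.
-/
theorem IsRegular.of_surjective (hE : IsABModule E) (hE' : IsABModule E') (hreg : IsRegular E)
    {p : E →ₗ[ABAlg] E'} (hp : Function.Surjective p) {e : E}
    (he : ∀ y : E, ∃ f : ABAlg, y = f • e) : IsRegular E' := by
  have := hE.2
  have := hE'.2
  rw [IsRegular, saturation_eq_cyclicSpan (exists_generator_of_surjective hp he),
    ← map_mapInvB_cyclicSpan, ← saturation_eq_cyclicSpan he]
  exact hreg.map _

/-- A submodule of a regular (a,b)-module is regular. -/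
theorem IsRegular.of_injective (hreg : IsRegular E') {i : E →ₗ[ABAlg] E'}
    (hi : Function.Injective i) : IsRegular E := by
  have hfin : Module.Finite (PowerSeries ℂ) (saturation E') := Module.Finite.iff_fg.2 hreg
  -- The preimage of `E'♯` contains `E` and is stable under `t`. So `E♯` embeds in a finite module
  -- over the Noetherian ring `ℂ⟦b⟧`.
  have hle : saturation E ≤ (saturation E').comap (mapInvB i) := by
    refine sInf_le ⟨?_, fun x hx => ?_⟩
    · rintro _ ⟨x, rfl⟩
      rw [Submodule.mem_comap, mapInvB_toInvB]
      exact toInvB_mem_saturation _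
    · rw [Submodule.mem_comap, ← tLin_apply, mapInvB_tLin]
      exact t_mem_saturation hx
  exact Module.Finite.iff_fg.1 (Module.Finite.of_injective
    ((mapInvB i).restrict (p := saturation E) (q := saturation E') fun _ h => hle h)
    fun x y hxy => Subtype.ext (mapInvB_injective hi (congrArg Subtype.val hxy)))

theorem finrank_eq_add {F G : Type*} [AddCommGroup F] [Module ABAlg F] [Module (PowerSeries ℂ) F]
    [IsScalarTower (PowerSeries ℂ) ABAlg F] [AddCommGroup G] [Module ABAlg G]
    [Module (PowerSeries ℂ) G] [IsScalarTower (PowerSeries ℂ) ABAlg G] (hE : IsABModule E)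
    (i : F →ₗ[ABAlg] E) (p : E →ₗ[ABAlg] G) (hi : Function.Injective i)
    (hip : Function.Exact i p) (hp : Function.Surjective p) :
    Module.finrank (PowerSeries ℂ) E =
      Module.finrank (PowerSeries ℂ) F + Module.finrank (PowerSeries ℂ) G := by
  have := hE.2
  have h1 := Submodule.finrank_quotient_add_finrank (LinearMap.ker (restrictSeries p))
  have h2 := LinearEquiv.finrank_eq ((restrictSeries p).quotKerEquivOfSurjective hp)
  have hker : LinearMap.ker (restrictSeries p) = LinearMap.range (restrictSeries i) := by
    ext x
    exact hip x
  have h3 := LinearEquiv.finrank_eq (LinearEquiv.ofInjective (restrictSeries i) hi)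
  rw [hker] at h1 h2
  rw [← h1, h2, h3, add_comm]

/-- If the generator of `F ⊂ E` is `x e`, with `e` a generator of `E` and
`x = b ^ g * c (b⁻¹ * a) + ⋯`, the characteristic polynomial of `E` divides the product of `c` and
the shifted characteristic polynomial of `F`. -/
theorem satCharpoly_dvd_comp_mul {F : Type*} [AddCommGroup F] [Module ABAlg F]
    [Module (PowerSeries ℂ) F] [IsScalarTower (PowerSeries ℂ) ABAlg F] (hF : IsABModule F)
    (hE : IsABModule E) (hregF : IsRegular F) (hreg : IsRegular E) (i : F →ₗ[ABAlg] E) {e : E}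
    (he : ∀ y : E, ∃ f : ABAlg, y = f • e) {f₀ : F} (hf₀ : ∀ y : F, ∃ f : ABAlg, y = f • f₀)
    {g : ℕ} {c : ℂ[X]} (hc : c.natDegree ≤ g) {R : ABAlg} (hR : IsRemainder g R)
    (hif : i f₀ = (homogenize g c + b ^ 2 * R) • e) :
    satCharpoly hreg ∣ (satCharpoly hregF).comp (X + (g : ℂ[X])) * c := by
  have := hF.2
  obtain ⟨U, rfl⟩ := hR.exists_eq_sum
  obtain ⟨m, hm, h1⟩ := (satCharpoly_dvd_iff hF hregF hf₀ _).1 dvd_rfl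
  replace h1 := congrArg (mapInvB i) h1
  -- Knowing only that `F♯` maps into `E♯` would not be enough, as `b^g` has to be cancelled. The
  -- image of `F♯` is the cyclic span of `b^g y` with `y = c(t) e + b m'`, hence lies in `b^g E♯`.
  have hm₁ := Submodule.mem_map_of_mem (f := mapInvB i) (saturation_eq_cyclicSpan hf₀ ▸ hm)
  rw [map_mapInvB_cyclicSpan, hif, toInvB_homogenize_add_smul hc] at hm₁
  rw [mapInvB_aeval_tLin, mapInvB_toInvB, hif, toInvB_homogenize_add_smul hc,
    isLeibniz_tLin.aeval_X_pow_smul, map_smul] at h1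
  set m' := ∑ j ∈ Finset.range g, U j • aeval tLin (ascPochhammer ℂ j) (toInvB e)
  have hm' : m' ∈ saturation E := sum_mem fun j _ => Submodule.smul_mem _ _
    (aeval_mem_saturation _ (toInvB_mem_saturation e))
  obtain ⟨m₂, hm₂, h2⟩ := isLeibniz_tLin.exists_of_mem_cyclicSpan_X_pow_smul g hm₁
  have hle : cyclicSpan tLin (aeval tLin c (toInvB e) + (PowerSeries.X : PowerSeries ℂ) • m') ≤
      saturation E := Submodule.span_le.2 <| by
    rintro _ ⟨p, rfl⟩
    exact aeval_mem_saturation p (add_mem (aeval_mem_saturation c (toInvB_mem_saturation e))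
      (Submodule.smul_mem _ _ hm'))
  rw [h2, smul_comm] at h1
  have h3 := X_pow_smul_injective _ h1
  -- The correction `b m'` is harmless: `q(t) b m' = b q(t + 1) m'` is again in `b E♯`.
  have h4 := isLeibniz_tLin.aeval_X_pow_smul ((satCharpoly hregF).comp (X + (g : ℂ[X]))) 1 m'
  rw [pow_one] at h4
  rw [map_add, h4] at h3
  rw [satCharpoly_dvd_iff hE hreg he, map_mul, Module.End.mul_apply]
  exact ⟨_, sub_mem (hle hm₂) (aeval_mem_saturation _ hm'),
    (eq_sub_of_add_eq h3).trans (smul_sub _ _ _).symm⟩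

end ABModule

/-! ### The theorem for an exact sequence. -/

open ABAlg ABModule

theorem mainTheorem7
    {F E G : Type*}
    [AddCommGroup F] [Module ABAlg F] [Module (PowerSeries ℂ) F]
    [IsScalarTower (PowerSeries ℂ) ABAlg F]
    [AddCommGroup E] [Module ABAlg E] [Module (PowerSeries ℂ) E]
    [IsScalarTower (PowerSeries ℂ) ABAlg E]
    [AddCommGroup G] [Module ABAlg G] [Module (PowerSeries ℂ) G]
    [IsScalarTower (PowerSeries ℂ) ABAlg G]
    (hF : ABModule.IsABModule F) (hE : ABModule.IsABModule E) (hG : ABModule.IsABModule G)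
    (hmono : ABModule.IsMonogenic E) (hreg : ABModule.IsRegular E)
    (i : F →ₗ[ABAlg] E) (p : E →ₗ[ABAlg] G)
    (hi : Function.Injective i) (hip : Function.Exact i p) (hp : Function.Surjective p) :
    ABModule.IsMonogenic F ∧ ABModule.IsMonogenic G ∧
    (∃! P : ABAlg, ABModule.IsBernsteinElement E P) ∧
    (∃! P : ABAlg, ABModule.IsBernsteinElement F P) ∧
    (∃! P : ABAlg, ABModule.IsBernsteinElement G P) ∧
    (∀ PE PF PG : ABAlg, ABModule.IsBernsteinElement E PE → ABModule.IsBernsteinElement F PF →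
      ABModule.IsBernsteinElement G PG → PE = PF * PG) ∧
    ∃ (hregF : ABModule.IsRegular F) (hregG : ABModule.IsRegular G),
      ABModule.bernsteinPolynomial hreg =
        (ABModule.bernsteinPolynomial hregF).comp
            (Polynomial.X - Polynomial.C (Module.finrank (PowerSeries ℂ) G : ℂ)) *
          ABModule.bernsteinPolynomial hregG := by
  obtain ⟨e, he⟩ := hmono.exists_generator
  have hgG := exists_generator_of_surjective hp he
  have hregG := hreg.of_surjective hE hG hp he
  have hregF := hreg.of_injective hi
  obtain ⟨R, hR, hI⟩ := exists_isRemainder_smul_eq_zero_iff hG hregG hgG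
  set g := Module.finrank (PowerSeries ℂ) G with hg
  set x := homogenize g (satCharpoly hregG) + b ^ 2 * R with hx
  -- As `x` generates the annihilator of `p e`, the kernel of `p` is `Ã x e`; so the preimage `f₀`
  -- of `x e` generates `F`.
  obtain ⟨f₀, hf₀⟩ := (hip (x • e)).1 (by
    rw [map_smul, hI]
    exact Submodule.mem_span_singleton_self _)
  have hgF : ∀ y : F, ∃ f : ABAlg, y = f • f₀ := fun y => by
    obtain ⟨f, hf⟩ := he (i y)
    have h1 : f • p e = 0 := by rw [← map_smul, ← hf, hip.apply_apply_eq_zero]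
    obtain ⟨q, rfl⟩ := Submodule.mem_span_singleton.1 ((hI f).1 h1)
    exact ⟨q, hi (by rw [hf, map_smul, hf₀, smul_eq_mul, mul_smul])⟩
  have hmF := isMonogenic_of_generator hgF
  have hmG := isMonogenic_of_generator hgG
  have hrank := finrank_eq_add hE i p hi hip hp
  have hdG := natDegree_satCharpoly hG hregG
  have hdF := natDegree_satCharpoly hF hregF
  have hcomp := (satCharpoly_monic hregF).comp_X_add_natCast g
  have hchar : satCharpoly hreg =
      (satCharpoly hregF).comp (X + (g : ℂ[X])) * satCharpoly hregG := by
    refine (eq_of_monic_of_dvd_of_natDegree_le (satCharpoly_monic hreg)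
      (hcomp.1.mul (satCharpoly_monic hregG))
      (satCharpoly_dvd_comp_mul hF hE hregF hreg i he hgF hdG.le hR hf₀) ?_).symm
    rw [hcomp.1.natDegree_mul (satCharpoly_monic hregG), hcomp.2, hdF, hdG,
      natDegree_satCharpoly hE, hrank]
  have hmul : homogenize (Module.finrank (PowerSeries ℂ) E) (satCharpoly hreg) =
      homogenize (Module.finrank (PowerSeries ℂ) F) (satCharpoly hregF) *
        homogenize g (satCharpoly hregG) := by
    rw [homogenize_mul hdF.le hdG.le, hchar, hrank]
  refine ⟨hmF, hmG, ?_, ?_, ?_, ?_, hregF, hregG, ?_⟩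
  · exact ⟨_, (isBernsteinElement_iff hE hmono hreg).2 rfl,
      fun P hP => (isBernsteinElement_iff hE hmono hreg).1 hP⟩
  · exact ⟨_, (isBernsteinElement_iff hF hmF hregF).2 rfl,
      fun P hP => (isBernsteinElement_iff hF hmF hregF).1 hP⟩
  · exact ⟨_, (isBernsteinElement_iff hG hmG hregG).2 rfl,
      fun P hP => (isBernsteinElement_iff hG hmG hregG).1 hP⟩
  · intro PE PF PG hPE hPF hPG
    rw [(isBernsteinElement_iff hE hmono hreg).1 hPE, (isBernsteinElement_iff hF hmF hregF).1 hPF,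
      (isBernsteinElement_iff hG hmG hregG).1 hPG, hmul]
  -- Evaluate `c_E(t) = c_F(t + g) c_G(t)` at `t = -x`, with `-x + g = -(x - g)`; the signs multiply
  -- because the ranks add.
  · rw [bernsteinPolynomial_eq hE, bernsteinPolynomial_eq hF, bernsteinPolynomial_eq hG, hchar,
      hrank, mul_comp, mul_comp, comp_assoc, comp_assoc, pow_add, ← hg]
    simp only [add_comp, X_comp, natCast_comp, neg_comp, pow_comp, one_comp, map_natCast]
    rw [show -(X - (g : ℂ[X])) = -X + (g : ℂ[X]) by ring]
    ring
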